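/- Fix $a\in\mathbb R$, $\epsilon>0$ and $R>0$ with $27R^6>4|a|^3$, and let $\alpha=e^{2\pi i/3}$. Let $\nu$ be the unique holomorphic function on $\{27|\lambda|^6>4|a|^3\}$ with $\nu(\lambda)^3-a\,\nu(\lambda)=\lambda^3$ and $\nu(\lambda)-\lambda\to0$ as $\lambda\to\infty$. *Regions.* Let $D=\{|\lambda|>R,\ -\tfrac{2\pi}3<\arg\lambda<-\tfrac\pi3\}$, $E=-D$, $$S=\{\alpha^2(z-iy),\ \alpha(-z-iy):z\ge R,\ 0\le y\le\epsilon\}\cup\{Re^{i\mu}:-\tfrac{2\pi}3\le\mu\le-\tfrac\pi3\},$$ $E'=E\setminus(\alpha S\cup\alpha^2S)$, and $\mathfrak s=\{z-iy:z\in\mathbb R,\ |z|\ge R,\ 0\le y\le\epsilon\}$. *Contours.* $\Gamma_-$ is the real line, oriented from left to right, with $(-R,R)$ replaced by the semicircle $|\lambda|=R$ in the closed upper half-plane. $\partial D$ is the positively oriented boundary of $D$. $\Gamma$ has the same circular arc as $\partial D$ and is oriented like it, but the rays of $\partial D$ are replaced by the rays $\{\alpha(-z-i\epsilon):z\ge R\}$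 and $\{\alpha^2(z-i\epsilon):z\ge R\}$, joined to the arc by the segments $\{\alpha(-R-iy):0\le y\le\epsilon\}$ and $\{\alpha^2(R-iy):0\le y\le\epsilon\}$. $\operatorname{PV}[\int_{\partial D}f+\int_\Gamma g]$ denotes the limit as $C\to\infty$ of the sum of the integrals in which all rays are truncated at $z\le C$ (in $\partial D$: at $|\lambda|\le C$). *Statement.* Let $\theta\in L^1\cap L^\infty(\Gamma_-)$ with respect to arc length, and suppose that $\theta$ extends to $\overline{\{\lambda\in\mathbb C^+:|\lambda|>R\}}$ and equals $\phi+\psi$ there, where $\phi$ and $\psi$ are holomorphic in $\{\lambda\in\mathbb C^+:|\lambda|>R\}$ and continuous up to its boundary. Suppose that $\psi(\lambda)=O(\lambda^{-4})$, uniformly in $\arg\lambda$, as $\lambda\to\infty$ within $\Gamma_-\cup\overline E$, that $\phi$ extends holomorphically to a neighbourhood of $\mathfrak s$, and that $\phi(\lambda)\to0$, uniformly in $\arg\lambda$, as $\lambda\to\infty$ within $\overline{E'}\cup\mathfrak s$. Then for every $k\in\{0,1,2\}$ and every $t>0$, the function $x\mapsto\int_{\Gamma_-}e^{i\nu(\lambda)x-i\lambda^3t}\theta(\lambda)\,d\lambda$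 is $k$ times continuously differentiable on $(-\infty,0)$, both limits below exist, and $$(-i)^k\lim_{x\to0^-}\partial_x^k\left[\int_{\Gamma_-}e^{i\nu(\lambda)x-i\lambda^3t}\theta(\lambda)\,d\lambda\right]=\operatorname{PV}\left[\int_{\partial D}e^{-i\lambda^3t}\left[\alpha\psi(\alpha\lambda)\nu(\alpha\lambda)^k+\alpha^2\psi(\alpha^2\lambda)\nu(\alpha^2\lambda)^k\right]d\lambda+\int_{\Gamma}e^{-i\lambda^3t}\left[\alpha\phi(\alpha\lambda)\nu(\alpha\lambda)^k+\alpha^2\phi(\alpha^2\lambda)\nu(\alpha^2\lambda)^k\right]d\lambda\right].$$ -/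

import Mathlib

open Complex Filter Topology MeasureTheory Set

noncomputable section

namespace VertexRewriting

/-- The primitive cube root of unity `α = exp(2πi/3)`. -/
def alpha : ℂ := exp (2 * Real.pi * I / 3)

/-! ### The function `ν` -/

/-- Auxiliary factor in the solution of the cubic: for `27 |l|⁶ > 4 |a|³` the principal powers are
taken of numbers in the open right half-plane. -/
def nuFactor (a : ℝ) (l : ℂ) : ℂ :=
  ((1 + (1 - 4 * (a : ℂ) ^ 3 / (27 * l ^ 6)) ^ (1 / 2 : ℂ)) / 2) ^ (1 / 3 : ℂ)

/-- The function `ν`: the branch of the solution of `ν³ - a ν = l³` with `ν(l) = l + o(1)` as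
`l → ∞`, holomorphic on the exterior domain `27 |l|⁶ > 4 |a|³`, given by Cardano's formula.
That it is this branch is `nu_cubic`, `nu_differentiableAt`, `nu_sub_self_tendsto` and
`nu_unique` below. -/
def nu (a : ℝ) (l : ℂ) : ℂ :=
  l * nuFactor a l + a / (3 * (l * nuFactor a l))

theorem nu_aux_re {a : ℝ} {l : ℂ} (h : 4 * |a| ^ 3 < 27 * ‖l‖ ^ 6) :
    0 < (1 - 4 * (a : ℂ) ^ 3 / (27 * l ^ 6)).re := by
  have h27 : 0 < 27 * ‖l‖ ^ 6 := lt_of_le_of_lt (by positivity) h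
  have h1 : ‖4 * (a : ℂ) ^ 3 / (27 * l ^ 6)‖ < 1 := by
    rw [norm_div, norm_mul, norm_mul, norm_pow, norm_pow, Complex.norm_real, Real.norm_eq_abs]
    norm_num
    rw [div_lt_one h27]
    exact h
  have h2 := (le_abs_self _).trans (Complex.abs_re_le_norm (4 * (a : ℂ) ^ 3 / (27 * l ^ 6)))
  simp only [sub_re, one_re]
  linarith

theorem cpow_half_re_pos {w : ℂ} (hw : 0 < w.re) : 0 < (w ^ (1 / 2 : ℂ)).re := by
  have hw0 : w ≠ 0 := by rintro rfl; simp at hw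
  rw [cpow_def_of_ne_zero hw0, exp_re]
  refine mul_pos (Real.exp_pos _) (Real.cos_pos_of_mem_Ioo ?_)
  have harg := abs_lt.1 ((Complex.abs_arg_lt_pi_div_two_iff).2 (Or.inl hw))
  have him : (log w * (1 / 2 : ℂ)).im = arg w / 2 := by
    rw [show log w * (1 / 2 : ℂ) = log w / 2 by ring]
    simp [log_im]
  rw [him]
  constructor <;> linarith [harg.1, harg.2, Real.pi_pos]

theorem nu_aux_re' {a : ℝ} {l : ℂ} (h : 4 * |a| ^ 3 < 27 * ‖l‖ ^ 6) :
    0 < ((1 + (1 - 4 * (a : ℂ) ^ 3 / (27 * l ^ 6)) ^ (1 / 2 : ℂ)) / 2).re := by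
  have := cpow_half_re_pos (nu_aux_re h)
  have e : ∀ w : ℂ, ((1 + w) / 2).re = (1 + w.re) / 2 := by intro w; simp
  rw [e]; linarith

theorem nuFactor_ne_zero {a : ℝ} {l : ℂ} (h : 4 * |a| ^ 3 < 27 * ‖l‖ ^ 6) :
    nuFactor a l ≠ 0 := by
  have h0 := nu_aux_re' h
  unfold nuFactor
  rw [Ne, cpow_eq_zero_iff]
  rintro ⟨h1, -⟩
  rw [h1] at h0
  simp at h0

theorem ne_zero_of_exterior {a : ℝ} {l : ℂ} (h : 4 * |a| ^ 3 < 27 * ‖l‖ ^ 6) : l ≠ 0 := by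
  rintro rfl
  have : 0 ≤ |a| ^ 3 := by positivity
  simp at h
  linarith

/-- `ν` solves the cubic equation `ν³ - a ν = l³`. -/
theorem nu_cubic {a : ℝ} {l : ℂ} (h : 4 * |a| ^ 3 < 27 * ‖l‖ ^ 6) :
    nu a l ^ 3 - a * nu a l = l ^ 3 := by
  have hl := ne_zero_of_exterior h
  have hf := nuFactor_ne_zero h
  set w : ℂ := (1 - 4 * (a : ℂ) ^ 3 / (27 * l ^ 6)) ^ (1 / 2 : ℂ) with hw
  have hw2 : w ^ 2 = 1 - 4 * (a : ℂ) ^ 3 / (27 * l ^ 6) := by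
    rw [hw, show (1 / 2 : ℂ) = ((2 : ℕ) : ℂ)⁻¹ by norm_num]
    exact cpow_nat_inv_pow _ two_ne_zero
  have hf3 : nuFactor a l ^ 3 = (1 + w) / 2 := by
    rw [nuFactor, show (1 / 3 : ℂ) = ((3 : ℕ) : ℂ)⁻¹ by norm_num]
    exact cpow_nat_inv_pow _ three_ne_zero
  have ha : (a : ℂ) ^ 3 = 27 * l ^ 6 * (1 - w ^ 2) / 4 := by
    rw [hw2]; field_simp; ring
  have hprod : ∀ u : ℂ, u ≠ 0 →
      (u + a / (3 * u)) ^ 3 - a * (u + a / (3 * u)) = u ^ 3 + (a : ℂ) ^ 3 / (27 * u ^ 3) := by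
    intro u hu; field_simp; ring
  have h1w : (1 + w) ≠ 0 := by
    intro h0
    have : nuFactor a l ^ 3 = 0 := by rw [hf3, h0]; simp
    exact hf (pow_eq_zero_iff three_ne_zero |>.1 this)
  rw [nu, hprod _ (mul_ne_zero hl hf), mul_pow, hf3, ha]
  field_simp
  ring

/-- `ν` is holomorphic on the exterior domain. -/
theorem nu_differentiableAt {a : ℝ} {l : ℂ} (h : 4 * |a| ^ 3 < 27 * ‖l‖ ^ 6) :
    DifferentiableAt ℂ (nu a) l := by
  have hl := ne_zero_of_exterior h
  have hf := nuFactor_ne_zero h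
  have d1 : DifferentiableAt ℂ (fun l : ℂ => 1 - 4 * (a : ℂ) ^ 3 / (27 * l ^ 6)) l := by
    refine (differentiableAt_const _).sub ((differentiableAt_const _).div (by fun_prop) ?_)
    exact mul_ne_zero (by norm_num) (pow_ne_zero _ hl)
  have d2 : DifferentiableAt ℂ (nuFactor a) l := by
    unfold nuFactor
    refine DifferentiableAt.cpow_const ?_ (Or.inl (nu_aux_re' h))
    refine ((differentiableAt_const _).add ?_).div_const _
    exact d1.cpow_const (Or.inl (nu_aux_re h))
  unfold nu
  have d3 : DifferentiableAt ℂ (fun l => l * nuFactor a l) l := differentiableAt_id.mul d2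
  exact d3.add ((differentiableAt_const _).div (d3.const_mul _)
    (mul_ne_zero (by norm_num) (mul_ne_zero hl hf)))

theorem eventually_exterior (a : ℝ) :
    ∀ᶠ l : ℂ in Bornology.cobounded ℂ, 4 * |a| ^ 3 < 27 * ‖l‖ ^ 6 := by
  have h6 : Tendsto (fun l : ℂ => 27 * ‖l‖ ^ 6) (Bornology.cobounded ℂ) atTop :=
    ((tendsto_pow_atTop (by norm_num)).comp tendsto_norm_cobounded_atTop).const_mul_atTop
      (by norm_num)
  exact h6.eventually_gt_atTop _

theorem nuFactor_tendsto (a : ℝ) :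
    Tendsto (nuFactor a) (Bornology.cobounded ℂ) (𝓝 1) := by
  have hinv : Tendsto (fun l : ℂ => 1 - 4 * (a : ℂ) ^ 3 / (27 * l ^ 6))
      (Bornology.cobounded ℂ) (𝓝 1) := by
    have h0 : Tendsto (fun l : ℂ => 1 - 4 * (a : ℂ) ^ 3 / 27 * (l⁻¹) ^ 6)
        (Bornology.cobounded ℂ) (𝓝 (1 - 4 * (a : ℂ) ^ 3 / 27 * 0 ^ 6)) :=
      tendsto_const_nhds.sub ((tendsto_inv₀_cobounded.pow 6).const_mul _)
    have e : (fun l : ℂ => 1 - 4 * (a : ℂ) ^ 3 / (27 * l ^ 6)) =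
        fun l : ℂ => 1 - 4 * (a : ℂ) ^ 3 / 27 * (l⁻¹) ^ 6 := by
      funext l; rw [inv_pow, div_mul_eq_div_div, div_eq_mul_inv _ (l ^ 6)]
    rw [e]
    simpa using h0
  have c : ContinuousAt (fun w : ℂ => ((1 + w ^ (1 / 2 : ℂ)) / 2) ^ (1 / 3 : ℂ)) 1 := by
    refine ContinuousAt.cpow (((continuousAt_const.add
      (continuousAt_id.cpow continuousAt_const ?_))).div_const _) continuousAt_const ?_
    · left; simp
    · left; simp
  have hc := c.tendsto.comp hinv
  have e1 : ((1 + (1 : ℂ) ^ (1 / 2 : ℂ)) / 2) ^ (1 / 3 : ℂ) = 1 := by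
    rw [one_cpow, show ((1 : ℂ) + 1) / 2 = 1 by norm_num, one_cpow]
  rw [e1] at hc
  exact hc

/-- `ν(l) / l → 1` at infinity. -/
theorem nu_div_tendsto (a : ℝ) :
    Tendsto (fun l => nu a l / l) (Bornology.cobounded ℂ) (𝓝 1) := by
  have h1 := nuFactor_tendsto a
  have h2 : Tendsto (fun l : ℂ => nuFactor a l + a / 3 * (nuFactor a l)⁻¹ * l⁻¹ ^ 2)
      (Bornology.cobounded ℂ) (𝓝 ((1 : ℂ) + (a : ℂ) / 3 * (1 : ℂ)⁻¹ * (0 : ℂ) ^ 2)) :=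
    h1.add (((h1.inv₀ one_ne_zero).const_mul _).mul (tendsto_inv₀_cobounded.pow 2))
  simp only [ne_eq, OfNat.ofNat_ne_zero, not_false_eq_true, zero_pow, mul_zero, add_zero] at h2
  refine h2.congr' ?_
  filter_upwards [eventually_exterior a] with l hl
  have hl0 := ne_zero_of_exterior hl
  have hf := nuFactor_ne_zero hl
  rw [nu]
  field_simp

/-- `ν(l) = l + o(1)` at infinity. -/
theorem nu_sub_self_tendsto (a : ℝ) :
    Tendsto (fun l => nu a l - l) (Bornology.cobounded ℂ) (𝓝 0) := by
  have hq := nu_div_tendsto a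
  have h3 : Tendsto (fun l : ℂ => a * (nu a l / l) *
      ((nu a l / l) ^ 2 + nu a l / l + 1)⁻¹ * l⁻¹) (Bornology.cobounded ℂ)
      (𝓝 (a * 1 * ((1 : ℂ) ^ 2 + 1 + 1)⁻¹ * 0)) :=
    ((hq.const_mul _).mul ((((hq.pow 2).add hq).add_const 1).inv₀ (by norm_num))).mul
      tendsto_inv₀_cobounded
  rw [mul_zero] at h3
  refine h3.congr' ?_
  have hne : ∀ᶠ l in Bornology.cobounded ℂ, (nu a l / l) ^ 2 + nu a l / l + 1 ≠ 0 :=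
    (((hq.pow 2).add hq).add_const 1).eventually_ne (by norm_num)
  filter_upwards [eventually_exterior a, hne] with l hl hn
  have hl0 := ne_zero_of_exterior hl
  have hc := nu_cubic hl
  have hn' : nu a l ^ 2 + nu a l * l + l ^ 2 ≠ 0 := by
    intro h0
    apply hn
    field_simp
    linear_combination h0
  have e : (nu a l / l) ^ 2 + nu a l / l + 1 = (nu a l ^ 2 + nu a l * l + l ^ 2) / l ^ 2 := by
    field_simp
  rw [e, inv_div]
  have e2 : (a : ℂ) * (nu a l / l) * (l ^ 2 / (nu a l ^ 2 + nu a l * l + l ^ 2)) * l⁻¹ =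
      a * nu a l / (nu a l ^ 2 + nu a l * l + l ^ 2) := by
    field_simp
  rw [e2, div_eq_iff hn']
  linear_combination -hc

/-- Near infinity, `ν` is the only solution of the cubic asymptotic to `l`. -/
theorem nu_unique (a : ℝ) (f : ℂ → ℂ)
    (hf : ∀ᶠ l in Bornology.cobounded ℂ, f l ^ 3 - a * f l = l ^ 3)
    (hf' : Tendsto (fun l => f l / l) (Bornology.cobounded ℂ) (𝓝 1)) :
    f =ᶠ[Bornology.cobounded ℂ] nu a := by
  have hq := nu_div_tendsto a
  have ht : Tendsto (fun l : ℂ => (f l / l) ^ 2 + f l / l * (nu a l / l) + (nu a l / l) ^ 2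
      - a * l⁻¹ ^ 2) (Bornology.cobounded ℂ) (𝓝 ((1 : ℂ) ^ 2 + 1 * 1 + 1 ^ 2 - a * 0 ^ 2)) :=
    (((hf'.pow 2).add (hf'.mul hq)).add (hq.pow 2)).sub
      ((tendsto_inv₀_cobounded.pow 2).const_mul _)
  have hne := ht.eventually_ne (b₂ := 0) (by norm_num)
  filter_upwards [eventually_exterior a, hne, hf] with l hl hn hfl
  have hl0 := ne_zero_of_exterior hl
  have hc := nu_cubic hl
  by_contra hcon
  apply hn
  have h1 : (f l - nu a l) * (f l ^ 2 + f l * nu a l + nu a l ^ 2 - a) = 0 := by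
    linear_combination hfl - hc
  have h2 := (mul_eq_zero.1 h1).resolve_left (sub_ne_zero.2 hcon)
  field_simp
  linear_combination h2

/-! ### Regions -/

/-- The open exterior half-plane `{l ∈ ℂ⁺ : |l| > R}`. -/
def upperExterior (R : ℝ) : Set ℂ := {l | 0 < l.im ∧ R < ‖l‖}

/-- The sector `D = {|l| > R, -2π/3 < arg l < -π/3}`. -/
def regionD (R : ℝ) : Set ℂ :=
  {l | R < ‖l‖ ∧ -(2 * Real.pi / 3) < arg l ∧ arg l < -(Real.pi / 3)}

/-- `E = -D`. -/
def regionE (R : ℝ) : Set ℂ := {l | -l ∈ regionD R}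

/-- The set `S`: two semistrips of width `ε` along the outer sides of the rays of `∂D`, together
with the circular arc of `∂D`. -/
def stripS (R ε : ℝ) : Set ℂ :=
  {l | ∃ z y : ℝ, R ≤ z ∧ 0 ≤ y ∧ y ≤ ε ∧ l = alpha ^ 2 * (z - I * y)} ∪
  {l | ∃ z y : ℝ, R ≤ z ∧ 0 ≤ y ∧ y ≤ ε ∧ l = alpha * (-z - I * y)} ∪
  {l | ∃ μ : ℝ, -(2 * Real.pi / 3) ≤ μ ∧ μ ≤ -(Real.pi / 3) ∧ l = R * exp (I * μ)}

/-- `E' = E \ (αS ∪ α²S)`. -/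
def regionE' (R ε : ℝ) : Set ℂ :=
  regionE R \ ((fun l => alpha * l) '' stripS R ε ∪ (fun l => alpha ^ 2 * l) '' stripS R ε)

/-- The closed set `𝔰` between `Γ₋` and its shifted version: two semistrips below the real rays. -/
def stripBelow (R ε : ℝ) : Set ℂ := {l | R ≤ |l.re| ∧ -ε ≤ l.im ∧ l.im ≤ 0}

/-! ### Contours -/

/-- The real line with `(-R, R)` replaced by the semicircle of radius `R` in the upper half-plane,
as a set. -/
def gammaMinus (R : ℝ) : Set ℂ :=
  {l | l.im = 0 ∧ R ≤ |l.re|} ∪ {l | 0 ≤ l.im ∧ ‖l‖ = R}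

/-- Arc length measure on `Γ₋`. -/
def gammaMinusMeasure (R : ℝ) : Measure ℂ :=
  Measure.map (fun s : ℝ => (s : ℂ)) (volume.restrict {s : ℝ | R ≤ |s|}) +
  ENNReal.ofReal R • Measure.map (fun μ : ℝ => (R : ℂ) * exp (I * μ))
    (volume.restrict (Icc 0 Real.pi))

/-- The contour integral of `f` along the smooth curve `c` from parameter `p` to parameter `q`. -/
def curveInt (c : ℝ → ℂ) (p q : ℝ) (f : ℂ → ℂ) : ℂ := ∫ s in p..q, f (c s) * deriv c s

/-- `∫_{Γ₋} f`, with `Γ₋` oriented from left to right. -/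
def intGammaMinus (R : ℝ) (f : ℂ → ℂ) : ℂ :=
  (∫ s in Iic (-R), f (s : ℂ)) +
  curveInt (fun μ => R * exp (I * μ)) Real.pi 0 f +
  ∫ s in Ici R, f (s : ℂ)

/-- `∫_{∂D} f` truncated to `|l| ≤ C`; `∂D` is positively oriented: inwards along the ray
`arg l = -π/3`, clockwise along the arc of radius `R`, outwards along the ray `arg l = -2π/3`. -/
def intBoundaryD (R C : ℝ) (f : ℂ → ℂ) : ℂ :=
  curveInt (fun z => alpha * (-z)) C R f +
  curveInt (fun μ => R * exp (I * μ)) (-(Real.pi / 3)) (-(2 * Real.pi / 3)) f +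
  curveInt (fun z => alpha ^ 2 * z) R C f

/-- `∫_Γ f` truncated at parameter `C` on both rays. `Γ` has the same arc as `∂D`; its rays are
those of `∂D` moved outwards by `ε`, that is, across the semistrips of `S`, joined to the arc by
the short ends of the semistrips. It is oriented like `∂D`. -/
def intGamma (R ε C : ℝ) (f : ℂ → ℂ) : ℂ :=
  curveInt (fun z => alpha * (-z - I * ε)) C R f +
  curveInt (fun y => alpha * (-R - I * y)) ε 0 f +
  curveInt (fun μ => R * exp (I * μ)) (-(Real.pi / 3)) (-(2 * Real.pi / 3)) f +
  curveInt (fun y => alpha ^ 2 * (R - I * y)) 0 ε f +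
  curveInt (fun z => alpha ^ 2 * (z - I * ε)) R C f

/-- The bracket `α f(αl) ν(αl)^k + α² f(α²l) ν(α²l)^k`. -/
def rotatedSum (a : ℝ) (k : ℕ) (f : ℂ → ℂ) (l : ℂ) : ℂ :=
  alpha * f (alpha * l) * nu a (alpha * l) ^ k +
  alpha ^ 2 * f (alpha ^ 2 * l) * nu a (alpha ^ 2 * l) ^ k

end VertexRewriting

end

open VertexRewriting

noncomputable section

namespace VertexRewriting

/-! The factor e^{-iλ³t} has modulus exp(t Im λ³), which is 1 on the real axis and decays like a
Gaussian along a horizontal ray below it. The two summands of θ are therefore treated differently on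
the rays of Γ₋. The decay ψ = O(λ⁻⁴) absorbs up to two factors ν, so the rays carrying ψ stay real.
The function φ tends to 0 at no known rate, so its rays are lowered by ε through 𝔰, at the cost of
two vertical segments (`integral_ray_eq`). Since ν - λ is bounded, Im ν is bounded on every piece of
the new contour. Hence e^{iνx} is harmless for x of either sign, and one may differentiate under the
integral up to order k ≤ 2. The integral is thus a C^k function of x on all of ℝ
(`intGammaMinus_eq_momentSum`, `derivChain_momentSum`), and the one-sided limit is its k-th
derivative at 0.

At x = 0 the exponent depends on λ³ alone, which is invariant under λ ↦ αλ. Rotation by α and α²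
therefore turns the bracketed sums over ∂D into integrals of the single weight e^{-iλ³t}ψν^k over
α∂D and α²∂D. Two of the four rotated rays are the real rays and the other two are the sides of E;
the rotated arcs cover the arc of Γ₋ except for its middle third. Cauchy's theorem in E, closed off
by a far horizontal chord, shows that the sides of E contribute exactly this missing arc in the
limit (`tendsto_sector_sides`). For φ and Γ the argument is the same, with the real rays lowered and
the sides moved into E, where Im λ³ again gives Gaussian smallness. The two limits
(`tendsto_intBoundaryD`, `tendsto_intGamma`) add up to the value found at x = 0
(`momentSum_at_zero`). -/

/-! ### Primitives on the exterior half-plane -/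

/-- A holomorphic function on the exterior half-plane has a primitive. -/
theorem exists_primitive_upperExterior {R : ℝ} (hR : 0 < R) {f : ℂ → ℂ}
    (hf : DifferentiableOn ℂ f (upperExterior R)) :
    ∃ P : ℂ → ℂ, ∀ l ∈ upperExterior R, HasDerivAt P (f l) l := by
  -- The logarithm carries the exterior half-plane to a half-strip. The strip is convex, so the
  -- pulled-back form f(e^w) e^w dw has a primitive there.
  set s : Set ℂ := {w | Real.log R < w.re ∧ 0 < w.im ∧ w.im < Real.pi} with hs
  have hconv : Convex ℝ s :=
    (convex_halfSpace_re_gt _).inter ((convex_halfSpace_im_gt _).inter (convex_halfSpace_im_lt _))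
  have hso : IsOpen s :=
    (isOpen_lt continuous_const continuous_re).inter
      ((isOpen_lt continuous_const continuous_im).inter (isOpen_lt continuous_im continuous_const))
  have hexp : ∀ w ∈ s, exp w ∈ upperExterior R := by
    rintro w ⟨h1, h2, h3⟩
    refine ⟨?_, ?_⟩
    · rw [exp_im]
      exact mul_pos (Real.exp_pos _) (Real.sin_pos_of_pos_of_lt_pi h2 h3)
    · rw [norm_exp]
      exact (Real.log_lt_iff_lt_exp hR).1 h1
  have hlog : ∀ l ∈ upperExterior R, log l ∈ s := by
    rintro l ⟨h1, h2⟩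
    refine ⟨?_, ?_, ?_⟩
    · rw [log_re]; exact Real.log_lt_log hR h2
    · rw [log_im]
      have h0 := arg_nonneg_iff.2 h1.le
      rcases h0.lt_or_eq with h | h
      · exact h
      · have := (arg_eq_zero_iff.1 h.symm).2
        linarith
    · rw [log_im]
      exact (arg_lt_pi_iff.2 (Or.inr h1.ne'))
  have hdiff : DifferentiableOn ℂ (fun w => f (exp w) * exp w) s :=
    (hf.comp differentiable_exp.differentiableOn hexp).mul differentiable_exp.differentiableOn
  obtain ⟨Q, hQ⟩ := hconv.exists_forall_hasDerivWithinAt hdiff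
  refine ⟨fun l => Q (log l), fun l hl => ?_⟩
  have hl0 : l ≠ 0 := by
    rintro rfl
    simpa using hl.1
  have h1 := (hQ _ (hlog l hl)).hasDerivAt (hso.mem_nhds (hlog l hl))
  have h2 : HasDerivAt log l⁻¹ l := hasDerivAt_log (Or.inr hl.1.ne')
  have h3 := h1.comp l h2
  rw [exp_log hl0] at h3
  rwa [mul_assoc, mul_inv_cancel₀ hl0, mul_one] at h3

/-- Contour integrals in the exterior half-plane are, up to its circular boundary, limits of
differences of a potential. -/
theorem exists_potential {R : ℝ} (hR : 0 < R) {f : ℂ → ℂ}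
    (hf : DiffContOnCl ℂ f (upperExterior R)) :
    ∃ P : ℝ → ℂ → ℂ, ∀ (c : ℝ → ℂ) (p q : ℝ), ContDiff ℝ 1 c →
      (∀ s ∈ uIcc p q, 0 < (c s).im ∧ R ≤ ‖c s‖) →
      Tendsto (fun ρ => P ρ (c q) - P ρ (c p)) (𝓝[>] 1) (𝓝 (curveInt c p q f)) := by
  obtain ⟨Q, hQ⟩ := exists_primitive_upperExterior hR hf.differentiableOn
  have hmem : ∀ (ρ : ℝ) (l : ℂ), 1 < ρ → 0 < l.im → R ≤ ‖l‖ → (ρ : ℂ) * l ∈ upperExterior R := by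
    intro ρ l hρ h1 h2
    refine ⟨?_, ?_⟩
    · rw [im_ofReal_mul]
      exact mul_pos (by linarith) h1
    · rw [norm_mul, norm_real, Real.norm_of_nonneg (by linarith)]
      nlinarith
  have hmem' : ∀ (ρ : ℝ) (l : ℂ), 1 ≤ ρ → 0 < l.im → R ≤ ‖l‖ →
      (ρ : ℂ) * l ∈ closure (upperExterior R) := by
    intro ρ l hρ h1 h2
    have hc : Tendsto (fun r : ℝ => (r : ℂ) * l) (𝓝[>] ρ) (𝓝 ((ρ : ℂ) * l)) :=
      (Continuous.tendsto (by fun_prop) _).mono_left nhdsWithin_le_nhds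
    refine mem_closure_of_tendsto hc ?_
    filter_upwards [self_mem_nhdsWithin] with r hr
    exact hmem r l (lt_of_le_of_lt hρ hr) h1 h2
  -- The primitive Q is known only in the open region, while the curve may run on the circle of
  -- radius R. A dilation by ρ > 1 moves the curve inside, and the division by ρ makes this a
  -- primitive of l ↦ f(ρl).
  refine ⟨fun ρ l => Q (ρ * l) / ρ, fun c p q hc hK => ?_⟩
  have hc' : Continuous (deriv c) := hc.continuous_deriv le_rfl
  have hcont : ContinuousOn (fun z : ℝ × ℝ => f (z.1 * c z.2) * deriv c z.2)
      (Icc 1 2 ×ˢ uIcc p q) := by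
    refine ContinuousOn.mul (hf.continuousOn.comp ?_ ?_) (by fun_prop)
    · have := hc.continuous
      fun_prop
    · rintro ⟨ρ, s⟩ ⟨h1, h2⟩
      exact hmem' ρ _ h1.1 (hK s h2).1 (hK s h2).2
  -- Compactness of [1,2] × [p,q] supplies a constant dominating function for the limit ρ → 1⁺.
  obtain ⟨B, hB⟩ := (isCompact_Icc.prod isCompact_uIcc).exists_bound_of_continuousOn hcont
  have hslice : ∀ ρ ∈ Icc (1 : ℝ) 2, ContinuousOn (fun s : ℝ => f (ρ * c s) * deriv c s)
      (uIcc p q) := fun ρ hρ =>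
    hcont.comp (f := fun s : ℝ => (ρ, s)) (by fun_prop) fun s hs => ⟨hρ, hs⟩
  have hnear : Ioc (1 : ℝ) 2 ∈ 𝓝[>] (1 : ℝ) := Ioc_mem_nhdsGT one_lt_two
  have hlim : Tendsto (fun ρ : ℝ => ∫ s in p..q, f (ρ * c s) * deriv c s) (𝓝[>] 1)
      (𝓝 (∫ s in p..q, f (((1 : ℝ) : ℂ) * c s) * deriv c s)) := by
    refine intervalIntegral.tendsto_integral_filter_of_dominated_convergence (fun _ => B) ?_ ?_
      intervalIntegrable_const ?_
    · filter_upwards [hnear] with ρ hρ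
      exact ((hslice ρ ⟨hρ.1.le, hρ.2⟩).mono uIoc_subset_uIcc).aestronglyMeasurable
        measurableSet_uIoc
    · filter_upwards [hnear] with ρ hρ
      exact ae_of_all _ fun s hs => hB (ρ, s) ⟨⟨hρ.1.le, hρ.2⟩, uIoc_subset_uIcc hs⟩
    · refine ae_of_all _ fun s hs => ?_
      have h1 : ContinuousWithinAt (fun ρ : ℝ => f (ρ * c s) * deriv c s) (Icc 1 2) 1 :=
        (hcont.comp (f := fun ρ : ℝ => (ρ, s)) (by fun_prop)
          (fun ρ hρ => ⟨hρ, uIoc_subset_uIcc hs⟩)) 1 (by norm_num)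
      refine h1.tendsto.mono_left ?_
      rw [← nhdsWithin_Ioc_eq_nhdsGT one_lt_two]
      exact nhdsWithin_mono _ Ioc_subset_Icc_self
  have heq : ∀ᶠ ρ : ℝ in 𝓝[>] 1, ∫ s in p..q, f (ρ * c s) * deriv c s =
      Q (ρ * c q) / ρ - Q (ρ * c p) / ρ := by
    filter_upwards [hnear] with ρ hρ
    have hρ0 : (ρ : ℂ) ≠ 0 := ofReal_ne_zero.2 (by linarith [hρ.1])
    refine intervalIntegral.integral_eq_sub_of_hasDerivAt (f := fun s : ℝ => Q (ρ * c s) / ρ)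
      (fun s hs => ?_) (hslice ρ ⟨hρ.1.le, hρ.2⟩).intervalIntegrable
    have d1 := hQ _ (hmem ρ _ hρ.1 (hK s hs).1 (hK s hs).2)
    have d2 : HasDerivAt (fun s : ℝ => (ρ : ℂ) * c s) (ρ * deriv c s) s :=
      ((hc.differentiable one_ne_zero s).hasDerivAt).const_mul _
    have d3 := (HasDerivAt.scomp s d1 d2).div_const (ρ : ℂ)
    refine HasDerivAt.congr_deriv d3 ?_
    rw [smul_eq_mul]
    field_simp
  simp only [ofReal_one, one_mul] at hlim
  exact hlim.congr' heq

/-! ### The cube root of unity -/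

theorem alpha_eq : alpha = ⟨-(1 / 2), √3 / 2⟩ := by
  have h : (2 * Real.pi * I / 3 : ℂ) = ((2 * Real.pi / 3 : ℝ) : ℂ) * I := by push_cast; ring
  have h2 : 2 * Real.pi / 3 = Real.pi - Real.pi / 3 := by ring
  rw [alpha, h, exp_ofReal_mul_I, h2]
  apply Complex.ext <;> simp [Real.cos_pi_sub, Real.sin_pi_sub, -ofReal_sub, -ofReal_div]

theorem sq_sqrt_three : √3 * √3 = 3 := Real.mul_self_sqrt (by norm_num)

theorem alpha_sq : alpha ^ 2 = ⟨-(1 / 2), -(√3 / 2)⟩ := by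
  rw [alpha_eq, pow_two]
  apply Complex.ext <;> simp <;> nlinarith [sq_sqrt_three]

theorem alpha_cubed : alpha ^ 3 = 1 := by
  rw [alpha, ← exp_nat_mul]
  convert exp_two_pi_mul_I using 2
  push_cast; ring

theorem norm_alpha : ‖alpha‖ = 1 := by
  have h : (2 * Real.pi * I / 3 : ℂ) = ((2 * Real.pi / 3 : ℝ) : ℂ) * I := by push_cast; ring
  rw [alpha, h, norm_exp_ofReal_mul_I]

theorem alpha_mul_arc (R μ : ℝ) :
    alpha * (R * exp (I * μ)) = R * exp (I * ((μ + 2 * Real.pi / 3 : ℝ) : ℂ)) := by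
  rw [alpha, mul_left_comm, ← exp_add]
  congr 2
  push_cast; ring

theorem alpha_sq_mul_arc (R μ : ℝ) :
    alpha ^ 2 * (R * exp (I * μ)) = R * exp (I * ((μ + 4 * Real.pi / 3 : ℝ) : ℂ)) := by
  rw [alpha, mul_left_comm, ← exp_nat_mul, ← exp_add]
  congr 2
  push_cast; ring

/-! ### The contour around the sector `E` -/

theorem norm_le_of_normSq {R : ℝ} {l : ℂ} (h : R ^ 2 ≤ l.re ^ 2 + l.im ^ 2) : R ≤ ‖l‖ := by
  refine abs_le_of_sq_le_sq' (b := ‖l‖) ?_ (norm_nonneg l) |>.2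
  rw [Complex.sq_norm, normSq_apply]
  linarith

theorem right_ray_re_im (z y : ℝ) : (alpha ^ 2 * (-z - I * y)).re = z / 2 - √3 / 2 * y ∧
    (alpha ^ 2 * (-z - I * y)).im = √3 / 2 * z + y / 2 := by
  rw [alpha_sq]
  constructor <;> simp <;> ring

theorem left_ray_re_im (z y : ℝ) : (alpha * (z - I * y)).re = -(z / 2 - √3 / 2 * y) ∧
    (alpha * (z - I * y)).im = √3 / 2 * z + y / 2 := by
  rw [alpha_eq]
  constructor <;> simp <;> ring

theorem right_ray_mem {R z y : ℝ} (hR : 0 < R) (hz : R ≤ z) (hy : 0 ≤ y) :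
    0 < (alpha ^ 2 * (-z - I * y)).im ∧ R ≤ ‖alpha ^ 2 * (-z - I * y)‖ := by
  obtain ⟨h1, h2⟩ := right_ray_re_im z y
  have h3 : 0 < √3 := by positivity
  refine ⟨?_, norm_le_of_normSq ?_⟩
  · rw [h2]; nlinarith
  · have : R ^ 2 ≤ z ^ 2 := pow_le_pow_left₀ hR.le hz 2
    rw [h1, h2]
    linear_combination this + sq_nonneg y - (z ^ 2 + y ^ 2) / 4 * sq_sqrt_three

theorem left_ray_mem {R z y : ℝ} (hR : 0 < R) (hz : R ≤ z) (hy : 0 ≤ y) :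
    0 < (alpha * (z - I * y)).im ∧ R ≤ ‖alpha * (z - I * y)‖ := by
  obtain ⟨h1, h2⟩ := left_ray_re_im z y
  have h3 : 0 < √3 := by positivity
  refine ⟨?_, norm_le_of_normSq ?_⟩
  · rw [h2]; nlinarith
  · have : R ^ 2 ≤ z ^ 2 := pow_le_pow_left₀ hR.le hz 2
    rw [h1, h2]
    linear_combination this + sq_nonneg y - (z ^ 2 + y ^ 2) / 4 * sq_sqrt_three

theorem arc_im (R μ : ℝ) : ((R : ℂ) * exp (I * μ)).im = R * Real.sin μ := by
  rw [mul_comm I, exp_ofReal_mul_I]; simp [-ofReal_sin, -ofReal_cos]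

theorem norm_arc {R : ℝ} (hR : 0 ≤ R) (μ : ℝ) : ‖(R : ℂ) * exp (I * μ)‖ = R := by
  rw [norm_mul, mul_comm I, norm_exp_ofReal_mul_I, norm_real, Real.norm_of_nonneg hR, mul_one]

theorem contDiff_arc (R : ℝ) : ContDiff ℝ 1 fun μ : ℝ => (R : ℂ) * exp (I * μ) := by
  have : ContDiff ℝ 1 fun μ : ℝ => (μ : ℂ) := ofRealCLM.contDiff
  fun_prop

/-- For each dilation ρ the potential differences telescope around the closed contour, so their
limit is zero. The ends of the two rays at parameter C are mirror images in the imaginary axis,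
hence the closing chord is horizontal; `hY` keeps it outside the disc. -/
theorem sector_contour {R ε C : ℝ} (hR : 0 < R) (hε : 0 ≤ ε) (hRC : R ≤ C)
    (hY : R ≤ √3 / 2 * C + ε / 2) {f : ℂ → ℂ} (hf : DiffContOnCl ℂ f (upperExterior R)) :
    curveInt (fun z => alpha ^ 2 * (-z - I * ε)) C R f +
    curveInt (fun y => alpha ^ 2 * (-R - I * y)) ε 0 f +
    curveInt (fun μ => R * exp (I * μ)) (Real.pi / 3) (2 * Real.pi / 3) f +
    curveInt (fun y => alpha * (R - I * y)) 0 ε f +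
    curveInt (fun z => alpha * (z - I * ε)) R C f +
    curveInt (fun x => x + (√3 / 2 * C + ε / 2 : ℝ) * I)
      (-(C / 2 - √3 / 2 * ε)) (C / 2 - √3 / 2 * ε) f = 0 := by
  obtain ⟨P, hP⟩ := exists_potential hR hf
  have hof : ContDiff ℝ 1 fun μ : ℝ => (μ : ℂ) := ofRealCLM.contDiff
  have t1 := hP (fun z => alpha ^ 2 * (-z - I * ε)) C R (by fun_prop) (fun s hs => by
    rw [uIcc_of_ge hRC] at hs
    exact right_ray_mem hR hs.1 hε)
  have t2 := hP (fun y => alpha ^ 2 * (-R - I * y)) ε 0 (by fun_prop) (fun s hs => by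
    rw [uIcc_of_ge hε] at hs
    exact right_ray_mem hR le_rfl hs.1)
  have t3 := hP (fun μ => R * exp (I * μ)) (Real.pi / 3) (2 * Real.pi / 3) (contDiff_arc R)
    (fun s hs => by
      have hpi := Real.pi_pos
      rw [uIcc_of_le (by linarith)] at hs
      refine ⟨?_, (norm_arc hR.le s).ge⟩
      rw [arc_im]
      exact mul_pos hR (Real.sin_pos_of_pos_of_lt_pi (by linarith [hs.1]) (by linarith [hs.2])))
  have t4 := hP (fun y => alpha * (R - I * y)) 0 ε (by fun_prop) (fun s hs => by
    rw [uIcc_of_le hε] at hs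
    exact left_ray_mem hR le_rfl hs.1)
  have t5 := hP (fun z => alpha * (z - I * ε)) R C (by fun_prop) (fun s hs => by
    rw [uIcc_of_le hRC] at hs
    exact left_ray_mem hR hs.1 hε)
  have t6 := hP (fun x => x + (√3 / 2 * C + ε / 2 : ℝ) * I)
    (-(C / 2 - √3 / 2 * ε)) (C / 2 - √3 / 2 * ε) (by fun_prop) (fun s hs => by
    have him : ((s : ℂ) + (√3 / 2 * C + ε / 2 : ℝ) * I).im = √3 / 2 * C + ε / 2 := by simp
    refine ⟨by rw [him]; linarith, norm_le_of_normSq ?_⟩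
    rw [him]
    nlinarith [sq_nonneg ((s : ℂ) + (√3 / 2 * C + ε / 2 : ℝ) * I).re])
  have hsum := ((((t1.add t2).add t3).add t4).add t5).add t6
  refine tendsto_nhds_unique hsum (tendsto_const_nhds.congr fun ρ => ?_)
  have e1 : alpha ^ 2 * (-(R : ℂ) - I * (0 : ℝ)) = R * exp (I * (Real.pi / 3 : ℝ)) := by
    rw [mul_comm I ((Real.pi / 3 : ℝ) : ℂ), exp_ofReal_mul_I, alpha_sq,
      Real.cos_pi_div_three, Real.sin_pi_div_three]
    apply Complex.ext <;> simp <;> ring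
  have e2 : alpha * ((R : ℂ) - I * (0 : ℝ)) = R * exp (I * (2 * Real.pi / 3 : ℝ)) := by
    rw [alpha, mul_comm]
    push_cast
    rw [mul_zero, sub_zero]
    congr 2; ring
  have e3 : ((C / 2 - √3 / 2 * ε : ℝ) : ℂ) + (√3 / 2 * C + ε / 2 : ℝ) * I =
      alpha ^ 2 * (-C - I * ε) := by
    obtain ⟨h1, h2⟩ := right_ray_re_im C ε
    apply Complex.ext
    · rw [h1]; simp
    · rw [h2]; simp
  have e4 : ((-(C / 2 - √3 / 2 * ε) : ℝ) : ℂ) + (√3 / 2 * C + ε / 2 : ℝ) * I =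
      alpha * (C - I * ε) := by
    obtain ⟨h1, h2⟩ := left_ray_re_im C ε
    apply Complex.ext
    · rw [h1]; simp
    · rw [h2]; simp
  simp only [e1, e2, e3, e4]
  ring

/-- If `f` is small on long horizontal chords, the two outer sides of the contour around `E`
together cancel its arc. -/
theorem tendsto_sector_sides {R ε : ℝ} (hR : 0 < R) (hε : 0 ≤ ε) {f : ℂ → ℂ}
    (hf : DiffContOnCl ℂ f (upperExterior R)) {b : ℝ → ℝ}
    (hb0 : Tendsto (fun C => b C * C) atTop (𝓝 0))
    (hb : ∀ᶠ C : ℝ in atTop, ∀ x : ℝ, |x| ≤ C / 2 - √3 / 2 * ε →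
      ‖f (x + (√3 / 2 * C + ε / 2 : ℝ) * I)‖ ≤ b C) :
    Tendsto (fun C : ℝ =>
      curveInt (fun z => alpha ^ 2 * (-z - I * ε)) C R f +
      curveInt (fun y => alpha ^ 2 * (-R - I * y)) ε 0 f +
      curveInt (fun y => alpha * (R - I * y)) 0 ε f +
      curveInt (fun z => alpha * (z - I * ε)) R C f) atTop
      (𝓝 (curveInt (fun μ => R * exp (I * μ)) (2 * Real.pi / 3) (Real.pi / 3) f)) := by
  have h3 : 0 < √3 := by positivity
  have hchord : Tendsto (fun C : ℝ => curveInt (fun x => x + (√3 / 2 * C + ε / 2 : ℝ) * I)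
      (-(C / 2 - √3 / 2 * ε)) (C / 2 - √3 / 2 * ε) f) atTop (𝓝 0) := by
    -- The chord has length C - √3 ε ≤ C, so its integral is at most b C * C.
    refine squeeze_zero_norm' ?_ hb0
    filter_upwards [hb, eventually_ge_atTop (√3 * ε)] with C hC hC2
    have hX : 0 ≤ C / 2 - √3 / 2 * ε := by linarith
    have hb1 : 0 ≤ b C := (norm_nonneg _).trans (hC 0 (by simpa using hX))
    refine (intervalIntegral.norm_integral_le_of_norm_le_const (C := b C) fun x hx => ?_).trans ?_
    · have hd : HasDerivAt (fun x : ℝ => (x : ℂ) + (√3 / 2 * C + ε / 2 : ℝ) * I) 1 x :=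
        (ofRealCLM.hasDerivAt (x := x)).add_const _
      rw [hd.deriv, mul_one]
      refine hC x (abs_le.2 ?_)
      rw [uIoc_of_le (by linarith)] at hx
      exact ⟨hx.1.le, hx.2⟩
    · rw [abs_of_nonneg (by linarith)]
      have : 0 ≤ √3 * ε := by positivity
      nlinarith
  have harc : curveInt (fun μ : ℝ => R * exp (I * μ)) (2 * Real.pi / 3) (Real.pi / 3) f =
      -curveInt (fun μ : ℝ => R * exp (I * μ)) (Real.pi / 3) (2 * Real.pi / 3) f :=
    intervalIntegral.integral_symm _ _
  rw [harc]
  have := (hchord.const_sub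
    (-curveInt (fun μ : ℝ => R * exp (I * μ)) (Real.pi / 3) (2 * Real.pi / 3) f))
  rw [sub_zero] at this
  refine this.congr' ?_
  filter_upwards [eventually_ge_atTop (2 * R), eventually_ge_atTop R] with C hC hC2
  have h32 : 1 ≤ √3 := by
    rw [Real.one_le_sqrt]; norm_num
  have := sector_contour hR hε hC2 (by nlinarith) hf
  linear_combination -this

/-! ### Shifting a horizontal ray -/

/-- Cauchy's theorem on the rectangle with real sides from R to C and height η, which may be
negative; `h0` removes the far vertical side as C → ∞. -/
theorem integral_ray_eq_shifted {R η : ℝ} {f : ℂ → ℂ}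
    (hd : ∀ l : ℂ, R ≤ l.re → l.im ∈ uIcc 0 η → DifferentiableAt ℂ f l)
    (h1 : IntegrableOn (fun z : ℝ => f z) (Ioi R))
    (h2 : IntegrableOn (fun z : ℝ => f (z + η * I)) (Ioi R))
    (h0 : ∀ δ > 0, ∀ᶠ C : ℝ in atTop, ∀ y ∈ uIcc 0 η, ‖f (C + y * I)‖ ≤ δ) :
    ∫ z in Ioi R, f (z : ℂ) =
      (∫ z : ℝ in Ioi R, f (z + η * I)) + I * ∫ y in (0 : ℝ)..η, f (R + y * I) := by
  have l1 := intervalIntegral_tendsto_integral_Ioi R h1 tendsto_id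
  have l2 := intervalIntegral_tendsto_integral_Ioi R h2 tendsto_id
  have l3 : Tendsto (fun C : ℝ => ∫ y in (0 : ℝ)..η, f (C + y * I)) atTop (𝓝 0) := by
    rw [Metric.tendsto_nhds]
    intro δ hδ
    -- The summand 1 makes the resulting bound strictly less than δ and covers η = 0.
    have hδ' : 0 < δ / (|η| + 1) := by positivity
    filter_upwards [h0 _ hδ'] with C hC
    rw [dist_zero_right]
    have hle := intervalIntegral.norm_integral_le_of_norm_le_const (a := 0) (b := η)
      (f := fun y : ℝ => f (C + y * I)) (C := δ / (|η| + 1))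
      fun y hy => hC y (uIoc_subset_uIcc hy)
    refine hle.trans_lt ?_
    rw [sub_zero, div_mul_eq_mul_div, div_lt_iff₀ (by positivity)]
    nlinarith [abs_nonneg η]
  have l4 := (l2.sub (l3.const_mul I)).add_const (I * ∫ y in (0 : ℝ)..η, f (R + y * I))
  rw [mul_zero, sub_zero] at l4
  refine tendsto_nhds_unique (l1.congr' ?_) l4
  filter_upwards [eventually_ge_atTop R] with C hC
  have key := integral_boundary_rect_eq_zero_of_differentiableOn f (R : ℂ) ⟨C, η⟩ (by
    intro l hl
    rw [mem_reProdIm] at hl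
    simp only [ofReal_re, ofReal_im, uIcc_of_le hC] at hl
    exact (hd l hl.1.1 hl.2).differentiableWithinAt)
  simp only [ofReal_re, ofReal_im, ofReal_zero, zero_mul, add_zero, smul_eq_mul] at key
  simp only [id]
  linear_combination key

/-! ### Bounds for `ν` -/

theorem exterior_of_le {a R : ℝ} (hR : 0 < R) (haR : 4 * |a| ^ 3 < 27 * R ^ 6) {l : ℂ}
    (hl : R ≤ ‖l‖) : 4 * |a| ^ 3 < 27 * ‖l‖ ^ 6 := by
  have : R ^ 6 ≤ ‖l‖ ^ 6 := pow_le_pow_left₀ hR.le hl 6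
  linarith

/-- The difference tends to 0 at infinity and is continuous on the remaining compact annulus. The
bound controls both Im ν on the contours and the growth of |ν|. -/
theorem exists_nu_sub_self_le {a R : ℝ} (hR : 0 < R) (haR : 4 * |a| ^ 3 < 27 * R ^ 6) :
    ∃ M : ℝ, 0 ≤ M ∧ ∀ l : ℂ, R ≤ ‖l‖ → ‖nu a l - l‖ ≤ M := by
  have h1 := (nu_sub_self_tendsto a).norm
  rw [norm_zero] at h1
  have h2 := h1.eventually_le_const one_pos
  rw [← comap_norm_atTop, eventually_comap] at h2
  obtain ⟨r, hr⟩ := eventually_atTop.1 h2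
  have hK : IsCompact (Metric.closedBall (0 : ℂ) r ∩ {l | R ≤ ‖l‖}) :=
    (isCompact_closedBall _ _).inter_right (isClosed_le continuous_const continuous_norm)
  have hc : ContinuousOn (fun l => nu a l - l) (Metric.closedBall (0 : ℂ) r ∩ {l | R ≤ ‖l‖}) :=
    fun l hl => ((nu_differentiableAt (exterior_of_le hR haR hl.2)).continuousAt.sub
      continuousAt_id).continuousWithinAt
  obtain ⟨B, hB⟩ := hK.exists_bound_of_continuousOn hc
  refine ⟨max B 1, by positivity, fun l hl => ?_⟩
  rcases le_total r ‖l‖ with h | h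
  · exact (hr _ h l rfl).trans (le_max_right _ _)
  · exact (hB l ⟨by simpa using h, hl⟩).trans (le_max_left _ _)

/-! ### Membership in the regions -/

theorem mem_closure_upperExterior {R : ℝ} {l : ℂ} (h0 : 0 ≤ l.im) (h : R ≤ ‖l‖) :
    l ∈ closure (upperExterior R) := by
  -- The direction l + i raises the imaginary part even at real points and increases the modulus
  -- even on the circle.
  have hc : Tendsto (fun r : ℝ => l + r * (l + I)) (𝓝[>] 0) (𝓝 (l + (0 : ℝ) * (l + I))) :=
    (Continuous.tendsto (by fun_prop) _).mono_left nhdsWithin_le_nhds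
  rw [ofReal_zero, zero_mul, add_zero] at hc
  refine mem_closure_of_tendsto hc ?_
  filter_upwards [self_mem_nhdsWithin] with r hr
  have hr : 0 < r := hr
  have him : (l + r * (l + I)).im = l.im + r * (l.im + 1) := by simp
  have hre : (l + r * (l + I)).re = l.re + r * l.re := by simp
  refine ⟨by rw [him]; positivity, lt_of_le_of_lt h ?_⟩
  refine lt_of_pow_lt_pow_left₀ 2 (norm_nonneg _) ?_
  rw [Complex.sq_norm, Complex.sq_norm, normSq_apply, normSq_apply, him, hre]
  have : 0 < r * (l.im + 1) := by positivity
  have : 0 ≤ l.im * (r * (l.im + 1)) := by positivity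
  nlinarith [mul_self_nonneg l.re, mul_pos hr hr, mul_self_nonneg (r * l.re)]

theorem mem_regionE {R : ℝ} {l : ℂ} (h : √3 * |l.re| < l.im) (hl : R < ‖l‖) :
    l ∈ regionE R := by
  have h3 : 0 < √3 := by positivity
  have him : 0 < l.im := lt_of_le_of_lt (by positivity) h
  have hl0 : 0 < ‖l‖ := norm_pos_iff.2 (by rintro rfl; simp at him)
  have hre : |l.re| < ‖l‖ / 2 := by
    refine lt_of_pow_lt_pow_left₀ 2 (by positivity) ?_
    rw [sq_abs, div_pow, Complex.sq_norm, normSq_apply]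
    have h4 : (√3 * |l.re|) ^ 2 < l.im ^ 2 := pow_lt_pow_left₀ h (by positivity) two_ne_zero
    rw [mul_pow, Real.sq_sqrt (by norm_num), sq_abs] at h4
    linarith
  rw [abs_lt] at hre
  -- In the open lower half-plane the argument is minus an arccosine, so the two bounds on it become
  -- the bounds ±1/2 on the cosine.
  have harg : arg (-l) = -Real.arccos ((-l).re / ‖-l‖) := arg_of_im_neg (by simpa using him)
  rw [norm_neg, neg_re] at harg
  have a1 : Real.arccos (1 / 2) = Real.pi / 3 := by
    rw [← Real.cos_pi_div_three, Real.arccos_cos] <;> linarith [Real.pi_pos]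
  have a2 : Real.arccos (-(1 / 2)) = 2 * Real.pi / 3 := by
    rw [Real.arccos_neg, a1]; ring
  have q1 : -l.re / ‖l‖ < 1 / 2 := by rw [div_lt_iff₀ hl0]; linarith
  have q2 : -(1 / 2) < -l.re / ‖l‖ := by rw [lt_div_iff₀ hl0]; linarith
  refine ⟨by rwa [norm_neg], ?_, ?_⟩
  · rw [harg, neg_lt_neg_iff]
    have := Real.strictAntiOn_arccos (a := -(1 / 2)) (by norm_num)
      (b := -l.re / ‖l‖) ⟨by linarith, by linarith⟩ q2
    linarith
  · rw [harg, neg_lt_neg_iff, ← a1]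
    exact Real.strictAntiOn_arccos ⟨by linarith, by linarith⟩ (by norm_num) q1

/-- Of the four rotated semistrips, two lie in the closed lower half-plane. On the other two, Im l -
√3 |Re l| ≤ 2y ≤ 2ε, which is the origin of the margin 2ε. The rotated arcs have modulus R. -/
theorem mem_regionE' {R ε : ℝ} (hR : 0 < R) (hε : 0 ≤ ε) {l : ℂ}
    (h : √3 * |l.re| + 2 * ε < l.im) (hl : R < ‖l‖) : l ∈ regionE' R ε := by
  have h3 : 0 < √3 := by positivity
  have him : 0 < l.im := lt_of_le_of_lt (by positivity) h
  have hp : √3 * l.re ≤ √3 * |l.re| := by gcongr; exact le_abs_self _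
  have hm : √3 * -l.re ≤ √3 * |l.re| := by gcongr; exact neg_le_abs _
  have c3 := alpha_cubed
  refine ⟨mem_regionE (by linarith) hl, ?_⟩
  rintro (⟨s, hs, rfl⟩ | ⟨s, hs, rfl⟩)
  · rcases hs with (⟨z, y, hz, hy, hyε, rfl⟩ | ⟨z, y, hz, hy, hyε, rfl⟩) | ⟨μ, -, -, rfl⟩
    · have e : alpha * (alpha ^ 2 * (z - I * y)) = z - I * y := by linear_combination (z - I * y) * c3
      simp only [e] at him
      simp at him
      linarith
    · have e : alpha * (alpha * (-z - I * y)) = alpha ^ 2 * (-z - I * y) := by ring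
      obtain ⟨r1, r2⟩ := right_ray_re_im z y
      simp only [e, r1, r2] at h hp
      nlinarith [sq_sqrt_three]
    · rw [norm_mul, norm_alpha, norm_arc hR.le] at hl
      linarith
  · rcases hs with (⟨z, y, hz, hy, hyε, rfl⟩ | ⟨z, y, hz, hy, hyε, rfl⟩) | ⟨μ, -, -, rfl⟩
    · have e : alpha ^ 2 * (alpha ^ 2 * (z - I * y)) = alpha * (z - I * y) := by
        linear_combination alpha * (z - I * y) * c3
      obtain ⟨r1, r2⟩ := left_ray_re_im z y
      simp only [e, r1, r2] at h hm
      nlinarith [sq_sqrt_three]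
    · have e : alpha ^ 2 * (alpha * (-z - I * y)) = -z - I * y := by
        linear_combination (-z - I * y) * c3
      simp only [e] at him
      simp at him
      linarith
    · rw [norm_mul, norm_pow, norm_alpha, norm_arc hR.le] at hl
      linarith

/-- The closed cone `√3 |Re l| + 2ε ≤ Im l` lies, away from the disc, in the closure of `E'`. -/
theorem mem_closure_of_cone {R ε : ℝ} {A : Set ℂ}
    (hA : ∀ l : ℂ, √3 * |l.re| + 2 * ε < l.im → R < ‖l‖ → l ∈ A) {l : ℂ}
    (h : √3 * |l.re| + 2 * ε ≤ l.im) (h0 : 0 ≤ l.im) (hl : R < ‖l‖) : l ∈ closure A := by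
  have hc : Tendsto (fun r : ℝ => l + r * I) (𝓝[>] 0) (𝓝 (l + (0 : ℝ) * I)) :=
    (Continuous.tendsto (by fun_prop) _).mono_left nhdsWithin_le_nhds
  rw [ofReal_zero, zero_mul, add_zero] at hc
  refine mem_closure_of_tendsto hc ?_
  filter_upwards [self_mem_nhdsWithin] with r hr
  have hr : 0 < r := hr
  have him : (l + r * I).im = l.im + r := by simp
  have hre : (l + r * I).re = l.re := by simp
  refine hA _ (by rw [him, hre]; linarith) (lt_of_lt_of_le hl ?_)
  refine norm_le_of_normSq ?_
  rw [Complex.sq_norm, normSq_apply, him, hre]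
  nlinarith

/-! ### Chains of derivatives -/

/-- `G 0, …, G k` are continuous and each is the derivative of its predecessor. -/
structure DerivChain (k : ℕ) (G : ℕ → ℝ → ℂ) : Prop where
  hasDerivAt : ∀ j < k, ∀ x, HasDerivAt (G j) (G (j + 1) x) x
  continuous : ∀ j ≤ k, Continuous (G j)

theorem DerivChain.add {k : ℕ} {G H : ℕ → ℝ → ℂ} (hG : DerivChain k G) (hH : DerivChain k H) :
    DerivChain k fun j x => G j x + H j x :=
  ⟨fun j hj x => (hG.hasDerivAt j hj x).add (hH.hasDerivAt j hj x),
    fun j hj => (hG.continuous j hj).add (hH.continuous j hj)⟩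

theorem DerivChain.iteratedDeriv_eq {k : ℕ} {G : ℕ → ℝ → ℂ} (hG : DerivChain k G) :
    ∀ j ≤ k, iteratedDeriv j (G 0) = G j := by
  intro j
  induction j with
  | zero => intro _; exact iteratedDeriv_zero
  | succ j ih =>
    intro hj
    rw [iteratedDeriv_succ, ih (by omega)]
    funext x
    exact (hG.hasDerivAt j hj x).deriv

theorem DerivChain.contDiff {k : ℕ} {G : ℕ → ℝ → ℂ} (hG : DerivChain k G) :
    ContDiff ℝ k (G 0) := by
  rw [contDiff_nat_iff_iteratedDeriv]
  refine ⟨fun j hj => ?_, fun j hj => ?_⟩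
  · rw [hG.iteratedDeriv_eq j hj]
    exact hG.continuous j hj
  · rw [hG.iteratedDeriv_eq j hj.le]
    exact fun x => (hG.hasDerivAt j hj x).differentiableAt

/-! ### Differentiation under the contour integral -/

/-- Only a bound on Im ν is needed and the sign of x plays no role; this is what extends the
integrals across x = 0. -/
theorem norm_exp_I_mul_le {n : ℂ} {M x : ℝ} (h : |n.im| ≤ M) :
    ‖exp (I * n * x)‖ ≤ Real.exp (|x| * M) := by
  rw [norm_exp]
  refine Real.exp_le_exp.2 ?_
  have : (I * n * x).re = -(n.im * x) := by simp
  rw [this]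
  refine (neg_le_abs _).trans ?_
  rw [abs_mul, mul_comm]
  gcongr

theorem aestronglyMeasurable_exp_I_mul {μ : Measure ℝ} {n : ℝ → ℂ}
    (hn : AEStronglyMeasurable n μ) (x : ℝ) :
    AEStronglyMeasurable (fun s => exp (I * n s * x)) μ :=
  (show Continuous fun z : ℂ => exp (I * z * x) by fun_prop).comp_aestronglyMeasurable hn

theorem integrable_exp_I_mul {μ : Measure ℝ} {n W : ℝ → ℂ} {M : ℝ}
    (hn : AEStronglyMeasurable n μ) (hM : ∀ᵐ s ∂μ, |(n s).im| ≤ M) (hW : Integrable W μ) (x : ℝ) :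
    Integrable (fun s => exp (I * n s * x) * W s) μ :=
  hW.bdd_mul (c := Real.exp (|x| * M)) (aestronglyMeasurable_exp_I_mul hn x)
    (hM.mono fun _ hs => norm_exp_I_mul_le hs)

theorem continuous_integral_exp_I_mul {μ : Measure ℝ} {n W : ℝ → ℂ} {M : ℝ}
    (hn : AEStronglyMeasurable n μ) (hM : ∀ᵐ s ∂μ, |(n s).im| ≤ M) (hW : Integrable W μ) :
    Continuous fun x : ℝ => ∫ s, exp (I * n s * x) * W s ∂μ := by
  rw [continuous_iff_continuousAt]
  intro x₀
  -- On the unit ball around x₀ one has |x| ≤ |x₀| + 1, which makes the bound uniform in x.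
  refine continuousAt_of_dominated (bound := fun s => Real.exp ((|x₀| + 1) * M) * ‖W s‖) ?_ ?_
    (hW.norm.const_mul _) ?_
  · exact Eventually.of_forall fun x => (integrable_exp_I_mul hn hM hW x).aestronglyMeasurable
  · filter_upwards [Metric.ball_mem_nhds x₀ one_pos] with x hx
    filter_upwards [hM] with s hs
    rw [norm_mul]
    gcongr
    refine (norm_exp_I_mul_le hs).trans (Real.exp_le_exp.2 ?_)
    have h0 : 0 ≤ M := (abs_nonneg _).trans hs
    rw [Metric.mem_ball, Real.dist_eq] at hx
    have := abs_sub_abs_le_abs_sub x x₀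
    gcongr
    linarith
  · exact ae_of_all _ fun s => by fun_prop

theorem hasDerivAt_integral_exp_I_mul {μ : Measure ℝ} {n W : ℝ → ℂ} {M : ℝ}
    (hn : AEStronglyMeasurable n μ) (hM : ∀ᵐ s ∂μ, |(n s).im| ≤ M) (hW : Integrable W μ)
    (hW1 : Integrable (fun s => n s * W s) μ) (x₀ : ℝ) :
    HasDerivAt (fun x : ℝ => ∫ s, exp (I * n s * x) * W s ∂μ)
      (I * ∫ s, exp (I * n s * x₀) * (n s * W s) ∂μ) x₀ := by
  have h := hasDerivAt_integral_of_dominated_loc_of_deriv_le (μ := μ) (x₀ := x₀)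
    (s := Metric.ball x₀ 1)
    (F := fun (x : ℝ) s => exp (I * n s * x) * W s)
    (F' := fun (x : ℝ) s => I * (exp (I * n s * x) * (n s * W s)))
    (bound := fun s => Real.exp ((|x₀| + 1) * M) * ‖n s * W s‖)
    (Metric.ball_mem_nhds x₀ one_pos)
    (Eventually.of_forall fun x => (integrable_exp_I_mul hn hM hW x).aestronglyMeasurable)
    (integrable_exp_I_mul hn hM hW x₀)
    ((integrable_exp_I_mul hn hM hW1 x₀).const_mul I).aestronglyMeasurable ?_
    (hW1.norm.const_mul _) ?_
  · rw [← integral_const_mul]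
    exact h.2
  · filter_upwards [hM] with s hs x hx
    rw [norm_mul, norm_I, one_mul, norm_mul]
    gcongr
    refine (norm_exp_I_mul_le hs).trans (Real.exp_le_exp.2 ?_)
    have h0 : 0 ≤ M := (abs_nonneg _).trans hs
    rw [Metric.mem_ball, Real.dist_eq] at hx
    have := abs_sub_abs_le_abs_sub x x₀
    gcongr
    linarith
  · refine ae_of_all _ fun s x _ => ?_
    have h1 : HasDerivAt (fun x : ℝ => I * n s * (x : ℂ)) (I * n s) x := by
      simpa using (ofRealCLM.hasDerivAt (x := x)).const_mul (I * n s)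
    exact (h1.cexp.mul_const (W s)).congr_deriv (by ring)

/-- The weight `e^{-i l³ t} χ(l) ν(l)^k`. -/
def oscWeight (a t : ℝ) (k : ℕ) (χ : ℂ → ℂ) (l : ℂ) : ℂ :=
  exp (-I * l ^ 3 * t) * χ l * nu a l ^ k

/-- The `j`-th `x`-derivative of the integral of `e^{iνx - il³t} χ` along a curve `c`. -/
def curveMoment (a t : ℝ) (χ : ℂ → ℂ) (c w : ℝ → ℂ) (μ : Measure ℝ) (j : ℕ) (x : ℝ) : ℂ :=
  I ^ j * ∫ s, exp (I * nu a (c s) * x) * (oscWeight a t j χ (c s) * w s) ∂μ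

/-- Each x-derivative produces a factor iν: the power of i is kept outside the integral, the power
of ν inside the weight. Integrability of the weights at x = 0 suffices for all x. -/
theorem derivChain_curveMoment {a t M : ℝ} {χ : ℂ → ℂ} {c w : ℝ → ℂ} {μ : Measure ℝ} {k : ℕ}
    (hn : AEStronglyMeasurable (fun s => nu a (c s)) μ) (hM : ∀ᵐ s ∂μ, |(nu a (c s)).im| ≤ M)
    (hW : ∀ j ≤ k, Integrable (fun s => oscWeight a t j χ (c s) * w s) μ) :
    DerivChain k (curveMoment a t χ c w μ) := by
  have e : ∀ j s, oscWeight a t (j + 1) χ (c s) * w s =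
      nu a (c s) * (oscWeight a t j χ (c s) * w s) := by
    intro j s
    simp only [oscWeight, pow_succ]
    ring
  refine ⟨fun j hj x => ?_, fun j hj => ?_⟩
  · have h1 := hW (j + 1) hj
    simp only [e] at h1
    refine ((hasDerivAt_integral_exp_I_mul hn hM (hW j hj.le) h1 x).const_mul (I ^ j)).congr_deriv ?_
    simp only [curveMoment, e, pow_succ, mul_assoc]
  · exact (continuous_integral_exp_I_mul hn hM (hW j hj)).const_mul _

theorem curveMoment_zero_right (a t : ℝ) (χ : ℂ → ℂ) (c w : ℝ → ℂ) (μ : Measure ℝ) (j : ℕ) :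
    (-I) ^ j * curveMoment a t χ c w μ j 0 = ∫ s, oscWeight a t j χ (c s) * w s ∂μ := by
  have h : (-I) ^ j * I ^ j = 1 := by rw [← mul_pow]; simp
  rw [curveMoment, ← mul_assoc, h, one_mul]
  simp

theorem curveMoment_zero_left (a t : ℝ) (χ : ℂ → ℂ) (c w : ℝ → ℂ) (μ : Measure ℝ) (x : ℝ) :
    curveMoment a t χ c w μ 0 x =
      ∫ s, exp (I * nu a (c s) * x - I * c s ^ 3 * t) * χ (c s) * w s ∂μ := by
  rw [curveMoment, pow_zero, one_mul]
  congr 1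
  funext s
  rw [oscWeight, sub_eq_add_neg, exp_add, pow_zero, mul_one, neg_mul, neg_mul]
  ring

/-! ### Regularity and decay of the weights -/

theorem norm_oscWeight (a t : ℝ) (k : ℕ) (χ : ℂ → ℂ) (l : ℂ) :
    ‖oscWeight a t k χ l‖ = Real.exp (t * (l ^ 3).im) * ‖χ l‖ * ‖nu a l‖ ^ k := by
  rw [oscWeight, norm_mul, norm_mul, norm_pow, norm_exp]
  congr 3
  simp [mul_comm]

theorem continuousOn_oscWeight {a R t : ℝ} (hR : 0 < R) (haR : 4 * |a| ^ 3 < 27 * R ^ 6) (k : ℕ)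
    {χ : ℂ → ℂ} {K : Set ℂ} (hK : ∀ l ∈ K, R ≤ ‖l‖) (hχ : ContinuousOn χ K) :
    ContinuousOn (oscWeight a t k χ) K := by
  have hν : ContinuousOn (nu a) K := fun l hl =>
    (nu_differentiableAt (exterior_of_le hR haR (hK l hl))).continuousAt.continuousWithinAt
  unfold oscWeight
  exact ((by fun_prop : ContinuousOn (fun l : ℂ => exp (-I * l ^ 3 * t)) K).mul hχ).mul (hν.pow k)

theorem closure_upperExterior_norm {R : ℝ} {l : ℂ} (hl : l ∈ closure (upperExterior R)) :
    R ≤ ‖l‖ :=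
  closure_minimal (t := {l : ℂ | R ≤ ‖l‖}) (fun _ h => h.2.le)
    (isClosed_le continuous_const continuous_norm) hl

theorem diffContOnCl_oscWeight {a R t : ℝ} (hR : 0 < R) (haR : 4 * |a| ^ 3 < 27 * R ^ 6) (k : ℕ)
    {χ : ℂ → ℂ} (hχ : DiffContOnCl ℂ χ (upperExterior R)) :
    DiffContOnCl ℂ (oscWeight a t k χ) (upperExterior R) := by
  refine ⟨?_, continuousOn_oscWeight hR haR k (fun l hl => closure_upperExterior_norm hl)
    hχ.continuousOn⟩
  have hν : DifferentiableOn ℂ (nu a) (upperExterior R) := fun l hl =>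
    (nu_differentiableAt (exterior_of_le hR haR hl.2.le)).differentiableWithinAt
  unfold oscWeight
  exact ((by fun_prop : DifferentiableOn ℂ (fun l : ℂ => exp (-I * l ^ 3 * t)) _).mul
    hχ.differentiableOn).mul (hν.pow k)

/-- For k ≤ 2 the growth is at most quadratic, so a factor of order |l|⁻⁴ leaves the integrable
|l|⁻². -/
theorem norm_nu_pow_le {a M : ℝ} {l : ℂ} {k : ℕ} (hk : k ≤ 2) (h : ‖nu a l - l‖ ≤ M)
    (hM : M ≤ ‖l‖) (h1 : 1 ≤ ‖l‖) : ‖nu a l‖ ^ k ≤ 4 * ‖l‖ ^ 2 := by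
  have h2 : ‖nu a l‖ ≤ 2 * ‖l‖ := by
    have := norm_le_norm_add_norm_sub' (nu a l) l
    linarith
  calc ‖nu a l‖ ^ k ≤ (2 * ‖l‖) ^ k := pow_le_pow_left₀ (norm_nonneg _) h2 k
    _ ≤ (2 * ‖l‖) ^ 2 := pow_le_pow_right₀ (by linarith) hk
    _ = 4 * ‖l‖ ^ 2 := by ring

/-- Gaussian decay dominates the growth of `ν ^ k`. -/
theorem norm_oscWeight_le_of_gaussian {a M ε t C : ℝ} {χ : ℂ → ℂ} {l : ℂ} {k : ℕ} (hk : k ≤ 2)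
    (ht : 0 < t) (hε : 0 < ε) (hν : ‖nu a l - l‖ ≤ M) (hCM : 2 * M ≤ C) (hC2 : 2 ≤ C)
    (hCε : ε ≤ C) (hl1 : C / 2 ≤ ‖l‖) (hl2 : ‖l‖ ≤ C + ε) (hl3 : (l ^ 3).im ≤ ε ^ 3 - 3 * C ^ 2 * ε)
    (hχ : ‖χ l‖ ≤ 1) :
    ‖oscWeight a t k χ l‖ ≤ 32 * Real.exp (t * ε ^ 3) / (9 * ε ^ 2 * t ^ 2) / C ^ 2 := by
  have hC : 0 < C := by linarith
  have hu : 0 < 3 * C ^ 2 * ε * t := by positivity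
  -- From e^u ≥ 1 + u + u²/2 with u = 3C²εt. The resulting C⁻⁴ beats the quadratic growth of ν^k,
  -- for which |l| ≤ C + ε ≤ 2C is used; the product of the constants is 2/9 · 16 = 32/9.
  have he : Real.exp (-(3 * C ^ 2 * ε * t)) ≤ 2 / (3 * C ^ 2 * ε * t) ^ 2 := by
    rw [Real.exp_neg, inv_eq_one_div, div_le_div_iff₀ (Real.exp_pos _) (by positivity)]
    have := Real.quadratic_le_exp_of_nonneg hu.le
    nlinarith
  have hexp : Real.exp (t * (l ^ 3).im) ≤ Real.exp (t * ε ^ 3) * (2 / (3 * C ^ 2 * ε * t) ^ 2) := by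
    calc Real.exp (t * (l ^ 3).im) ≤ Real.exp (t * ε ^ 3 + -(3 * C ^ 2 * ε * t)) := by
          refine Real.exp_le_exp.2 ?_
          nlinarith
      _ = Real.exp (t * ε ^ 3) * Real.exp (-(3 * C ^ 2 * ε * t)) := Real.exp_add _ _
      _ ≤ _ := by gcongr
  have hp := norm_nu_pow_le hk hν (by linarith) (by linarith)
  have hl4 : ‖l‖ ^ 2 ≤ (2 * C) ^ 2 := pow_le_pow_left₀ (norm_nonneg _) (by linarith) 2
  rw [norm_oscWeight]
  calc Real.exp (t * (l ^ 3).im) * ‖χ l‖ * ‖nu a l‖ ^ k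
      ≤ (Real.exp (t * ε ^ 3) * (2 / (3 * C ^ 2 * ε * t) ^ 2)) * 1 * (4 * (2 * C) ^ 2) := by
        gcongr
        linarith
    _ = 32 * Real.exp (t * ε ^ 3) / (9 * ε ^ 2 * t ^ 2) / C ^ 2 := by
        field_simp
        ring

/-- Where Im l³ ≤ 0 the exponential has modulus at most 1, so the decay comes from χ alone: 4K/|l|²
with |l| ≥ C/2. -/
theorem norm_oscWeight_le_of_pow {a M t C K : ℝ} {χ : ℂ → ℂ} {l : ℂ} {k : ℕ} (hk : k ≤ 2)
    (ht : 0 < t) (hν : ‖nu a l - l‖ ≤ M) (hCM : 2 * M ≤ C) (hC2 : 2 ≤ C) (hK : 0 ≤ K)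
    (hl1 : C / 2 ≤ ‖l‖) (hl3 : (l ^ 3).im ≤ 0) (hχ : ‖χ l‖ ≤ K * (‖l‖ ^ 4)⁻¹) :
    ‖oscWeight a t k χ l‖ ≤ 16 * K / C ^ 2 := by
  have hC : 0 < C := by linarith
  have hl0 : 0 < ‖l‖ := by linarith
  have hexp : Real.exp (t * (l ^ 3).im) ≤ 1 := Real.exp_le_one_iff.2 (by nlinarith)
  have hp := norm_nu_pow_le hk hν (by linarith) (by linarith)
  have hl4 : (C / 2) ^ 2 ≤ ‖l‖ ^ 2 := pow_le_pow_left₀ (by positivity) hl1 2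
  rw [norm_oscWeight]
  calc Real.exp (t * (l ^ 3).im) * ‖χ l‖ * ‖nu a l‖ ^ k
      ≤ 1 * (K * (‖l‖ ^ 4)⁻¹) * (4 * ‖l‖ ^ 2) := by gcongr
    _ = 4 * K / ‖l‖ ^ 2 := by field_simp
    _ ≤ 4 * K / (C / 2) ^ 2 := by gcongr
    _ = 16 * K / C ^ 2 := by field_simp; ring

theorem eventually_cobounded_principal {A : Set ℂ} {p : ℂ → Prop} :
    (∀ᶠ l in Bornology.cobounded ℂ ⊓ 𝓟 A, p l) ↔ ∃ r : ℝ, ∀ l ∈ A, r ≤ ‖l‖ → p l := by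
  rw [eventually_inf_principal, ← comap_norm_atTop, eventually_comap, eventually_atTop]
  refine exists_congr fun r => ⟨fun h l hl hr => h _ hr l rfl hl, ?_⟩
  rintro h b hb l rfl hl
  exact h l hl hb

theorem exists_bound_of_isBigO {A : Set ℂ} {ψ : ℂ → ℂ}
    (h : ψ =O[Bornology.cobounded ℂ ⊓ 𝓟 A] fun l => l ^ (-4 : ℤ)) :
    ∃ K r : ℝ, 0 ≤ K ∧ ∀ l ∈ A, r ≤ ‖l‖ → ‖ψ l‖ ≤ K * (‖l‖ ^ 4)⁻¹ := by
  obtain ⟨K, hK, hb⟩ := h.exists_nonneg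
  obtain ⟨r, hr⟩ := eventually_cobounded_principal.1 hb.bound
  refine ⟨K, r, hK, fun l hl h => ?_⟩
  have := hr l hl h
  rwa [norm_zpow, zpow_neg] at this

theorem exists_bound_of_tendsto {A : Set ℂ} {φ : ℂ → ℂ}
    (h : Tendsto φ (Bornology.cobounded ℂ ⊓ 𝓟 A) (𝓝 0)) {δ : ℝ} (hδ : 0 < δ) :
    ∃ r : ℝ, ∀ l ∈ A, r ≤ ‖l‖ → ‖φ l‖ ≤ δ := by
  have h1 := h.norm
  rw [norm_zero] at h1
  exact eventually_cobounded_principal.1 (h1.eventually_le_const hδ)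

theorem integrableOn_Ioi_of_inv_sq {R K : ℝ} {g : ℝ → ℂ} (hg : ContinuousOn g (Ici R))
    (hb : ∀ᶠ z : ℝ in atTop, ‖g z‖ ≤ K / z ^ 2) : IntegrableOn g (Ioi R) := by
  refine ((hg.locallyIntegrableOn measurableSet_Ici).integrableOn_of_isBigO_atTop
    (g := fun z : ℝ => z ^ (-2 : ℝ)) ?_ ?_).mono_set Ioi_subset_Ici_self
  · refine Asymptotics.IsBigO.of_bound K ?_
    filter_upwards [hb, eventually_gt_atTop 0] with z hz hz0
    rw [Real.norm_of_nonneg (by positivity), Real.rpow_neg hz0.le]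
    simpa [div_eq_mul_inv] using hz
  · exact ⟨Ioi 1, Ioi_mem_atTop 1, integrableOn_Ioi_rpow_of_lt (by norm_num) one_pos⟩

/-! ### The horizontal rays -/

theorem ray_norm_bounds {σ z y : ℝ} (hσ : |σ| = 1) (hz : 0 ≤ z) (hy : 0 ≤ y) :
    z ≤ ‖(σ * z - I * y : ℂ)‖ ∧ ‖(σ * z - I * y : ℂ)‖ ≤ z + y := by
  have hs : σ ^ 2 = 1 := by rw [← sq_abs, hσ, one_pow]
  constructor
  · refine norm_le_of_normSq ?_
    simp
    rw [mul_pow, hs]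
    nlinarith
  · refine (norm_sub_le _ _).trans ?_
    simp [hσ, abs_of_nonneg hz, abs_of_nonneg hy]

/-- The source of the Gaussian decay at depth y > 0. The sign σ = ±1 selects the right or left ray
and drops out. -/
theorem ray_cube_im {σ z y : ℝ} (hσ : |σ| = 1) :
    ((σ * z - I * y : ℂ) ^ 3).im = y ^ 3 - 3 * z ^ 2 * y := by
  have hs : σ ^ 2 = 1 := by rw [← sq_abs, hσ, one_pow]
  have : ((σ * z - I * y : ℂ) ^ 3).im = y ^ 3 - 3 * (σ ^ 2 * z ^ 2) * y := by
    simp [pow_succ]; ring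
  rw [this, hs, one_mul]

theorem ray_mem_stripBelow {R ε σ z y : ℝ} (hσ : |σ| = 1) (hR : 0 < R) (hz : R ≤ z)
    (hy : 0 ≤ y) (hyε : y ≤ ε) : (σ * z - I * y : ℂ) ∈ stripBelow R ε := by
  refine ⟨?_, ?_, ?_⟩
  · simp [abs_mul, hσ, abs_of_nonneg (hR.le.trans hz), hz]
  · simpa using hyε
  · simpa using hy

theorem integrableOn_oscWeight_real {a R t : ℝ} (hR : 0 < R) (haR : 4 * |a| ^ 3 < 27 * R ^ 6)
    {A : Set ℂ} {ψ : ℂ → ℂ} (hψ : DiffContOnCl ℂ ψ (upperExterior R))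
    (hA : gammaMinus R ⊆ A)
    (hψO : ψ =O[Bornology.cobounded ℂ ⊓ 𝓟 A] fun l => l ^ (-4 : ℤ))
    {k : ℕ} (hk : k ≤ 2) (ht : 0 < t) {σ : ℝ} (hσ : |σ| = 1) :
    IntegrableOn (fun z : ℝ => oscWeight a t k ψ (σ * z)) (Ioi R) := by
  obtain ⟨M, hM0, hM⟩ := exists_nu_sub_self_le hR haR
  obtain ⟨K, r, hK, hr⟩ := exists_bound_of_isBigO hψO
  have hz0 : ∀ z : ℝ, R ≤ z → ‖(σ * z : ℂ)‖ = z := by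
    intro z hz
    simp [hσ, abs_of_nonneg (hR.le.trans hz)]
  refine integrableOn_Ioi_of_inv_sq (K := 16 * K) ?_ ?_
  · refine (diffContOnCl_oscWeight hR haR k hψ).continuousOn.comp (by fun_prop) fun z hz => ?_
    refine mem_closure_upperExterior (by simp) ?_
    rw [hz0 z hz]
    exact hz
  · filter_upwards [eventually_ge_atTop R, eventually_ge_atTop r, eventually_ge_atTop (2 * M),
      eventually_ge_atTop 2] with z h1 h2 h3 h4
    have hn := hz0 z h1
    refine norm_oscWeight_le_of_pow hk ht (hM _ (by rwa [hn])) h3 h4 hK (by rw [hn]; linarith)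
      ?_ (hr _ (hA (Or.inl ⟨by simp, ?_⟩)) (by rwa [hn]))
    · have := ray_cube_im (z := z) (y := 0) hσ
      simp only [ofReal_zero, mul_zero, sub_zero] at this
      rw [this]; simp
    · simp [abs_mul, hσ, abs_of_nonneg (hR.le.trans h1), h1]

/-- Boundedness of φ far out is enough here, since the lowered ray has Gaussian decay. -/
theorem integrableOn_oscWeight_shifted {a R ε t : ℝ} (hR : 0 < R)
    (haR : 4 * |a| ^ 3 < 27 * R ^ 6) (hε : 0 < ε) {A : Set ℂ} {φ : ℂ → ℂ}
    (hφs : ContinuousOn φ (stripBelow R ε)) (hA : stripBelow R ε ⊆ A)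
    (hφ0 : Tendsto φ (Bornology.cobounded ℂ ⊓ 𝓟 A) (𝓝 0))
    {k : ℕ} (hk : k ≤ 2) (ht : 0 < t) {σ : ℝ} (hσ : |σ| = 1) :
    IntegrableOn (fun z : ℝ => oscWeight a t k φ (σ * z - I * ε)) (Ioi R) := by
  obtain ⟨M, hM0, hM⟩ := exists_nu_sub_self_le hR haR
  obtain ⟨r, hr⟩ := exists_bound_of_tendsto hφ0 one_pos
  refine integrableOn_Ioi_of_inv_sq
    (K := 32 * Real.exp (t * ε ^ 3) / (9 * ε ^ 2 * t ^ 2)) ?_ ?_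
  · have hK : ∀ l ∈ (fun z : ℝ => (σ * z - I * ε : ℂ)) '' Ici R, R ≤ ‖l‖ := by
      rintro _ ⟨z, hz, rfl⟩
      exact le_trans hz (ray_norm_bounds hσ (hR.le.trans hz) hε.le).1
    have := continuousOn_oscWeight (t := t) hR haR k hK (hφs.mono (by
      rintro _ ⟨z, hz, rfl⟩
      exact ray_mem_stripBelow hσ hR hz hε.le le_rfl))
    exact this.comp (by fun_prop) (mapsTo_image _ _)
  · filter_upwards [eventually_ge_atTop R, eventually_ge_atTop r, eventually_ge_atTop (2 * M),
      eventually_ge_atTop 2, eventually_ge_atTop ε] with z h1 h2 h3 h4 h5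
    obtain ⟨n1, n2⟩ := ray_norm_bounds (y := ε) hσ (hR.le.trans h1) hε.le
    exact norm_oscWeight_le_of_gaussian hk ht hε (hM _ (h1.trans n1)) h3 h4 h5 (by linarith) n2
      (ray_cube_im hσ).le (hr _ (hA (ray_mem_stripBelow hσ hR h1 hε.le le_rfl)) (h2.trans n1))

/-! ### The sides of the sector `E` -/

/-- On the chord at height Y, Im l³ = 3x²Y - Y³ is largest at the ends. These are rotations of ±C -
iε by cube roots of unity, so the maximum is Im (±C - iε)³ = ε³ - 3C²ε. The ends also lie exactly on
the boundary of the cone √3 |Re l| + 2ε ≤ Im l. -/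
theorem chord_bounds {C ε x : ℝ} (hε : 0 ≤ ε) (hC : 0 ≤ C) (hx : |x| ≤ C / 2 - √3 / 2 * ε) :
    C / 2 ≤ ‖(x + (√3 / 2 * C + ε / 2 : ℝ) * I : ℂ)‖ ∧
    ‖(x + (√3 / 2 * C + ε / 2 : ℝ) * I : ℂ)‖ ≤ C + ε ∧
    ((x + (√3 / 2 * C + ε / 2 : ℝ) * I : ℂ) ^ 3).im ≤ ε ^ 3 - 3 * C ^ 2 * ε ∧
    √3 * |(x + (√3 / 2 * C + ε / 2 : ℝ) * I : ℂ).re| + 2 * ε ≤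
      (x + (√3 / 2 * C + ε / 2 : ℝ) * I : ℂ).im := by
  have h3 := sq_sqrt_three
  have h30 : 0 < √3 := by positivity
  have h31 : 1 ≤ √3 := by rw [Real.one_le_sqrt]; norm_num
  have hre : (x + (√3 / 2 * C + ε / 2 : ℝ) * I : ℂ).re = x := by simp
  have him : (x + (√3 / 2 * C + ε / 2 : ℝ) * I : ℂ).im = √3 / 2 * C + ε / 2 := by simp
  set l : ℂ := x + (√3 / 2 * C + ε / 2 : ℝ) * I with hl
  have hx2 : x ^ 2 ≤ (C / 2 - √3 / 2 * ε) ^ 2 := by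
    rw [← sq_abs]
    exact pow_le_pow_left₀ (abs_nonneg _) hx 2
  have hY : 0 ≤ √3 / 2 * C + ε / 2 := by positivity
  refine ⟨?_, ?_, ?_, ?_⟩
  · refine le_trans ?_ (abs_im_le_norm l)
    rw [him, abs_of_nonneg hY]
    nlinarith
  · refine (abs_le_of_sq_le_sq' ?_ (by positivity)).2
    rw [Complex.sq_norm, normSq_apply, hre, him]
    nlinarith [mul_nonneg hC hε]
  · have e : (l ^ 3).im = 3 * x ^ 2 * (√3 / 2 * C + ε / 2) - (√3 / 2 * C + ε / 2) ^ 3 := by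
      have : (l ^ 3).im = 3 * l.re ^ 2 * l.im - l.im ^ 3 := by
        simp only [pow_succ, pow_zero, one_mul, mul_im, mul_re]
        ring
      rw [this, hre, him]
    have e2 : 3 * (C / 2 - √3 / 2 * ε) ^ 2 * (√3 / 2 * C + ε / 2) - (√3 / 2 * C + ε / 2) ^ 3 =
        ε ^ 3 - 3 * C ^ 2 * ε := by
      linear_combination (-(√3 * C ^ 3) - 9 * C ^ 2 * ε + 3 * √3 * C * ε ^ 2 + 3 * ε ^ 3) / 8 * h3
    rw [e, ← e2]
    gcongr
  · rw [hre, him]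
    nlinarith

theorem tendsto_const_div_sq_mul (K : ℝ) : Tendsto (fun C : ℝ => K / C ^ 2 * C) atTop (𝓝 0) := by
  refine (tendsto_const_nhds.div_atTop tendsto_id : Tendsto (fun C : ℝ => K / C) atTop (𝓝 0)).congr'
    ?_
  filter_upwards [eventually_gt_atTop 0] with C hC
  field_simp

theorem tendsto_sides_of_decay {a R t : ℝ} (hR : 0 < R) (haR : 4 * |a| ^ 3 < 27 * R ^ 6)
    {ψ : ℂ → ℂ} (hψ : DiffContOnCl ℂ ψ (upperExterior R)) {A : Set ℂ}
    (hA : closure (regionE R) ⊆ A)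
    (hψO : ψ =O[Bornology.cobounded ℂ ⊓ 𝓟 A] fun l => l ^ (-4 : ℤ))
    {k : ℕ} (hk : k ≤ 2) (ht : 0 < t) :
    Tendsto (fun C : ℝ =>
      curveInt (fun z => alpha ^ 2 * (-z)) C R (oscWeight a t k ψ) +
      curveInt (fun z => alpha * z) R C (oscWeight a t k ψ)) atTop
      (𝓝 (curveInt (fun μ => R * exp (I * μ)) (2 * Real.pi / 3) (Real.pi / 3)
        (oscWeight a t k ψ))) := by
  obtain ⟨M, hM0, hM⟩ := exists_nu_sub_self_le hR haR
  obtain ⟨K, r, hK, hr⟩ := exists_bound_of_isBigO hψO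
  -- With ε = 0 the short segments degenerate and the rays are the sides of E themselves.
  have h := tendsto_sector_sides (ε := 0) hR le_rfl (diffContOnCl_oscWeight (t := t) hR haR k hψ)
    (tendsto_const_div_sq_mul (16 * K)) ?_
  · refine h.congr fun C => ?_
    simp [curveInt]
  · filter_upwards [eventually_gt_atTop (2 * R), eventually_ge_atTop (2 * r),
      eventually_ge_atTop (2 * M), eventually_ge_atTop 2] with C h1 h2 h3 h4 x hx
    obtain ⟨b1, b2, b3, b4⟩ := chord_bounds le_rfl (by linarith) hx
    refine norm_oscWeight_le_of_pow hk ht (hM _ (by linarith)) h3 h4 hK b1 (by simpa using b3)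
      (hr _ (hA ?_) (by linarith))
    refine mem_closure_of_cone (ε := 0) (fun l hl h => mem_regionE (by linarith) h) b4 ?_
      (by linarith)
    exact le_trans (by positivity) b4

/-- On the sides of E the number l³ is real and φ has no rate of decay. Moving the sides into E by ε
makes Im l³ very negative on the whole chord, which stays in the closure of E'. -/
theorem tendsto_sides_of_gaussian {a R ε t : ℝ} (hR : 0 < R) (haR : 4 * |a| ^ 3 < 27 * R ^ 6)
    (hε : 0 < ε) {φ : ℂ → ℂ} (hφ : DiffContOnCl ℂ φ (upperExterior R)) {A : Set ℂ}
    (hA : closure (regionE' R ε) ⊆ A)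
    (hφ0 : Tendsto φ (Bornology.cobounded ℂ ⊓ 𝓟 A) (𝓝 0))
    {k : ℕ} (hk : k ≤ 2) (ht : 0 < t) :
    Tendsto (fun C : ℝ =>
      curveInt (fun z => alpha ^ 2 * (-z - I * ε)) C R (oscWeight a t k φ) +
      curveInt (fun y => alpha ^ 2 * (-R - I * y)) ε 0 (oscWeight a t k φ) +
      curveInt (fun y => alpha * (R - I * y)) 0 ε (oscWeight a t k φ) +
      curveInt (fun z => alpha * (z - I * ε)) R C (oscWeight a t k φ)) atTop
      (𝓝 (curveInt (fun μ => R * exp (I * μ)) (2 * Real.pi / 3) (Real.pi / 3)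
        (oscWeight a t k φ))) := by
  obtain ⟨M, hM0, hM⟩ := exists_nu_sub_self_le hR haR
  obtain ⟨r, hr⟩ := exists_bound_of_tendsto hφ0 one_pos
  refine tendsto_sector_sides hR hε.le (diffContOnCl_oscWeight (t := t) hR haR k hφ)
    (tendsto_const_div_sq_mul (32 * Real.exp (t * ε ^ 3) / (9 * ε ^ 2 * t ^ 2))) ?_
  filter_upwards [eventually_gt_atTop (2 * R), eventually_ge_atTop (2 * r),
    eventually_ge_atTop (2 * M), eventually_ge_atTop 2, eventually_ge_atTop ε]
    with C h1 h2 h3 h4 h5 x hx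
  obtain ⟨b1, b2, b3, b4⟩ := chord_bounds hε.le (by linarith) hx
  refine norm_oscWeight_le_of_gaussian hk ht hε (hM _ (by linarith)) h3 h4 h5 b1 b2 b3
    (hr _ (hA ?_) (by linarith))
  refine mem_closure_of_cone (ε := ε) (fun l hl h => mem_regionE' hR hε.le hl h) b4 ?_
    (by linarith)
  exact le_trans (by positivity) b4

/-! ### Contour integrals of rotated sums -/

theorem curveInt_comp_add (c : ℝ → ℂ) (p q d : ℝ) (f : ℂ → ℂ) :
    curveInt (fun s => c (s + d)) p q f = curveInt c (p + d) (q + d) f := by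
  simp only [curveInt, deriv_comp_add_const]
  exact intervalIntegral.integral_comp_add_right (fun s => f (c s) * deriv c s) d

theorem curveInt_symm (c : ℝ → ℂ) (p q : ℝ) (f : ℂ → ℂ) :
    curveInt c q p f = -curveInt c p q f :=
  intervalIntegral.integral_symm _ _

theorem intervalIntegrable_curve {f : ℂ → ℂ} {K : Set ℂ} (hf : ContinuousOn f K) {c : ℝ → ℂ}
    (hc : ContDiff ℝ 1 c) {p q : ℝ} (hK : ∀ s ∈ uIcc p q, c s ∈ K) :
    IntervalIntegrable (fun s => f (c s) * deriv c s) volume p q :=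
  ((hf.comp hc.continuous.continuousOn hK).mul
    (hc.continuous_deriv le_rfl).continuousOn).intervalIntegrable

/-- Since (αl)³ = l³, the exponential may be read at the rotated point. The prefactors α and α² are
the derivatives of the rotations, so each term becomes an integral over a rotated curve. -/
theorem rotatedSum_eq (a t : ℝ) (k : ℕ) (χ : ℂ → ℂ) (l : ℂ) :
    exp (-I * l ^ 3 * t) * rotatedSum a k χ l =
      alpha * oscWeight a t k χ (alpha * l) + alpha ^ 2 * oscWeight a t k χ (alpha ^ 2 * l) := by
  have h1 : (alpha * l) ^ 3 = l ^ 3 := by linear_combination l ^ 3 * alpha_cubed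
  have h2 : (alpha ^ 2 * l) ^ 3 = l ^ 3 := by
    linear_combination l ^ 3 * (alpha ^ 3 + 1) * alpha_cubed
  simp only [oscWeight, rotatedSum, h1, h2]
  ring

theorem curveInt_rotatedSum {a t : ℝ} {k : ℕ} {χ : ℂ → ℂ} {K : Set ℂ}
    (hχ : ContinuousOn (oscWeight a t k χ) K) {c : ℝ → ℂ} (hc : ContDiff ℝ 1 c) {p q : ℝ}
    (h1 : ∀ s ∈ uIcc p q, alpha * c s ∈ K) (h2 : ∀ s ∈ uIcc p q, alpha ^ 2 * c s ∈ K) :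
    curveInt c p q (fun l => exp (-I * l ^ 3 * t) * rotatedSum a k χ l) =
      curveInt (fun s => alpha * c s) p q (oscWeight a t k χ) +
      curveInt (fun s => alpha ^ 2 * c s) p q (oscWeight a t k χ) := by
  unfold curveInt
  rw [← intervalIntegral.integral_add
    (intervalIntegrable_curve hχ (contDiff_const.mul hc) h1)
    (intervalIntegrable_curve hχ (contDiff_const.mul hc) h2)]
  congr 1
  funext s
  beta_reduce
  rw [rotatedSum_eq, deriv_const_mul_field, deriv_const_mul_field]
  ring

theorem curveInt_alpha_arc (R p q : ℝ) (f : ℂ → ℂ) :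
    curveInt (fun μ => alpha * (R * exp (I * μ))) p q f =
      curveInt (fun μ => R * exp (I * μ)) (p + 2 * Real.pi / 3) (q + 2 * Real.pi / 3) f := by
  simp only [alpha_mul_arc]
  exact curveInt_comp_add (fun μ => R * exp (I * μ)) p q _ f

theorem curveInt_alpha_sq_arc (R p q : ℝ) (f : ℂ → ℂ) :
    curveInt (fun μ => alpha ^ 2 * (R * exp (I * μ))) p q f =
      curveInt (fun μ => R * exp (I * μ)) (p + 4 * Real.pi / 3) (q + 4 * Real.pi / 3) f := by
  simp only [alpha_sq_mul_arc]
  exact curveInt_comp_add (fun μ => R * exp (I * μ)) p q _ f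

theorem arc_mem {R : ℝ} (hR : 0 < R) {K : Set ℂ} (hK : ∀ l : ℂ, 0 ≤ l.im → R ≤ ‖l‖ → l ∈ K)
    {μ : ℝ} (hμ : μ ∈ Icc 0 Real.pi) : (R : ℂ) * exp (I * μ) ∈ K := by
  refine hK _ ?_ (norm_arc hR.le μ).ge
  rw [arc_im]
  exact mul_nonneg hR.le (Real.sin_nonneg_of_mem_Icc hμ)

/-- The rotated arcs of `∂D`, completed by the arc of `∂E`, make up the arc of `Γ₋`. -/
theorem curveInt_arc_rotatedSum {a R t : ℝ} (hR : 0 < R) {k : ℕ} {χ : ℂ → ℂ} {K : Set ℂ}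
    (hK : ∀ l : ℂ, 0 ≤ l.im → R ≤ ‖l‖ → l ∈ K) (hχ : ContinuousOn (oscWeight a t k χ) K) :
    curveInt (fun μ => R * exp (I * μ)) (-(Real.pi / 3)) (-(2 * Real.pi / 3))
      (fun l => exp (-I * l ^ 3 * t) * rotatedSum a k χ l) +
    curveInt (fun μ => R * exp (I * μ)) (2 * Real.pi / 3) (Real.pi / 3) (oscWeight a t k χ) =
      curveInt (fun μ => R * exp (I * μ)) Real.pi 0 (oscWeight a t k χ) := by
  have hpi := Real.pi_pos
  have hI : ∀ p q : ℝ, p ∈ Icc 0 Real.pi → q ∈ Icc 0 Real.pi → IntervalIntegrable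
      (fun s : ℝ => oscWeight a t k χ (R * exp (I * s)) *
        deriv (fun μ : ℝ => (R : ℂ) * exp (I * μ)) s) volume p q := fun p q hp hq =>
    intervalIntegrable_curve hχ (contDiff_arc R) fun s hs =>
      arc_mem hR hK (uIcc_subset_Icc hp hq hs)
  rw [curveInt_rotatedSum hχ (contDiff_arc R), curveInt_alpha_arc, curveInt_alpha_sq_arc]
  -- The rotation by α gives the arc from π/3 to 0, that by α² the arc from π to 2π/3; the gap from
  -- 2π/3 to π/3 is the arc of ∂E.
  · have e1 : -(Real.pi / 3) + 2 * Real.pi / 3 = Real.pi / 3 := by ring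
    have e2 : -(2 * Real.pi / 3) + 2 * Real.pi / 3 = 0 := by ring
    have e3 : -(Real.pi / 3) + 4 * Real.pi / 3 = Real.pi := by ring
    have e4 : -(2 * Real.pi / 3) + 4 * Real.pi / 3 = 2 * Real.pi / 3 := by ring
    rw [e1, e2, e3, e4]
    have m1 : Real.pi / 3 ∈ Icc 0 Real.pi := ⟨by positivity, by linarith⟩
    have m2 : 2 * Real.pi / 3 ∈ Icc 0 Real.pi := ⟨by positivity, by linarith⟩
    have m3 : Real.pi ∈ Icc 0 Real.pi := ⟨hpi.le, le_rfl⟩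
    have m4 : (0 : ℝ) ∈ Icc 0 Real.pi := ⟨le_rfl, hpi.le⟩
    unfold curveInt
    rw [← intervalIntegral.integral_add_adjacent_intervals (hI _ _ m3 m2) (hI _ _ m2 m4),
      ← intervalIntegral.integral_add_adjacent_intervals (hI _ _ m2 m1) (hI _ _ m1 m4)]
    ring
  · intro s hs
    rw [uIcc_of_ge (by linarith)] at hs
    rw [alpha_mul_arc]
    exact arc_mem hR hK ⟨by linarith [hs.1], by linarith [hs.2]⟩
  · intro s hs
    rw [uIcc_of_ge (by linarith)] at hs
    rw [alpha_sq_mul_arc]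
    exact arc_mem hR hK ⟨by linarith [hs.1], by linarith [hs.2]⟩

theorem curveInt_line (u v : ℂ) (p q : ℝ) (f : ℂ → ℂ) :
    curveInt (fun s : ℝ => u * s + v) p q f = (∫ s in p..q, f (u * s + v)) * u := by
  have h : ∀ s : ℝ, deriv (fun s : ℝ => u * (s : ℂ) + v) s = u := fun s => by
    have := ((ofRealCLM.hasDerivAt (x := s)).const_mul u).add_const v
    simpa using this.deriv
  simp only [curveInt, h, intervalIntegral.integral_mul_const]

theorem curveInt_right_ray (R C y : ℝ) (f : ℂ → ℂ) :
    curveInt (fun z : ℝ => z - I * y) R C f = ∫ z in R..C, f ((1 : ℝ) * z - I * y) := by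
  have := curveInt_line 1 (-(I * y)) R C f
  simpa [sub_eq_add_neg] using this

theorem curveInt_left_ray (R C y : ℝ) (f : ℂ → ℂ) :
    curveInt (fun z : ℝ => -z - I * y) C R f = ∫ z in R..C, f ((-1 : ℝ) * z - I * y) := by
  have := curveInt_line (-1) (-(I * y)) C R f
  rw [intervalIntegral.integral_symm] at this
  simpa [sub_eq_add_neg] using this

/-- Two rotated rays land on the real axis and converge by integrability of the weight; the other
two are the sides of E and supply the middle third of the arc. -/
theorem tendsto_intBoundaryD {a R t : ℝ} (hR : 0 < R) (haR : 4 * |a| ^ 3 < 27 * R ^ 6)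
    {ψ : ℂ → ℂ} (hψ : DiffContOnCl ℂ ψ (upperExterior R))
    (hψO : ψ =O[Bornology.cobounded ℂ ⊓ 𝓟 (gammaMinus R ∪ closure (regionE R))]
      fun l => l ^ (-4 : ℤ)) {k : ℕ} (hk : k ≤ 2) (ht : 0 < t) :
    Tendsto (fun C : ℝ =>
      intBoundaryD R C fun l => exp (-I * l ^ 3 * t) * rotatedSum a k ψ l) atTop
      (𝓝 ((∫ z : ℝ in Ioi R, oscWeight a t k ψ ((1 : ℝ) * z)) +
        (∫ z : ℝ in Ioi R, oscWeight a t k ψ ((-1 : ℝ) * z)) +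
        curveInt (fun μ => R * exp (I * μ)) Real.pi 0 (oscWeight a t k ψ))) := by
  have hK : ∀ l : ℂ, 0 ≤ l.im → R ≤ ‖l‖ → l ∈ {l : ℂ | 0 ≤ l.im ∧ R ≤ ‖l‖} :=
    fun l h1 h2 => ⟨h1, h2⟩
  have hcont : ContinuousOn (oscWeight a t k ψ) {l : ℂ | 0 ≤ l.im ∧ R ≤ ‖l‖} :=
    (diffContOnCl_oscWeight hR haR k hψ).continuousOn.mono fun l hl =>
      mem_closure_upperExterior hl.1 hl.2
  have r1 := intervalIntegral_tendsto_integral_Ioi R (integrableOn_oscWeight_real hR haR hψ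
    subset_union_left hψO hk ht (σ := 1) (by simp)) tendsto_id
  have r2 := intervalIntegral_tendsto_integral_Ioi R (integrableOn_oscWeight_real hR haR hψ
    subset_union_left hψO hk ht (σ := -1) (by simp)) tendsto_id
  have r3 := tendsto_sides_of_decay hR haR hψ subset_union_right hψO hk ht
  have r := ((r1.add r2).add r3).add_const
    (curveInt (fun μ => R * exp (I * μ)) (-(Real.pi / 3)) (-(2 * Real.pi / 3))
      (fun l => exp (-I * l ^ 3 * t) * rotatedSum a k ψ l))
  rw [← curveInt_arc_rotatedSum hR hK hcont,
    add_comm (curveInt _ (-(Real.pi / 3)) (-(2 * Real.pi / 3)) _), ← add_assoc]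
  refine r.congr' ?_
  have hof : ContDiff ℝ 1 fun μ : ℝ => (μ : ℂ) := ofRealCLM.contDiff
  filter_upwards [eventually_ge_atTop R] with C hC
  have c3 := alpha_cubed
  have a1 : ∀ z : ℝ, alpha * (alpha * (-z)) = alpha ^ 2 * (-z) := fun z => by ring
  have a2 : ∀ z : ℝ, alpha ^ 2 * (alpha * (-z)) = -z - I * (0 : ℝ) := fun z => by
    rw [ofReal_zero]; linear_combination -z * c3
  have a3 : ∀ z : ℝ, alpha * (alpha ^ 2 * z) = z - I * (0 : ℝ) := fun z => by
    rw [ofReal_zero]; linear_combination z * c3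
  have a4 : ∀ z : ℝ, alpha ^ 2 * (alpha ^ 2 * z) = alpha * z := fun z => by
    linear_combination alpha * z * c3
  have hz : ∀ z : ℝ, 0 ≤ z → ‖(z : ℂ)‖ = z := fun z hz => by
    rw [norm_real, Real.norm_of_nonneg hz]
  unfold intBoundaryD
  rw [curveInt_rotatedSum hcont (c := fun z : ℝ => alpha * (-z)) (by fun_prop),
    curveInt_rotatedSum hcont (c := fun z : ℝ => alpha ^ 2 * z) (by fun_prop)]
  · simp only [a1, a2, a3, a4]
    rw [curveInt_right_ray, curveInt_left_ray]
    simp only [ofReal_zero, mul_zero, sub_zero, id]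
    ring
  · intro s hs
    rw [uIcc_of_le hC] at hs
    rw [a3]
    exact ⟨by simp, by simpa using hs.1.trans (le_abs_self s)⟩
  · intro s hs
    rw [uIcc_of_le hC] at hs
    rw [a4]
    have := left_ray_mem (y := 0) hR hs.1 le_rfl
    rw [ofReal_zero, mul_zero, sub_zero] at this
    exact ⟨this.1.le, this.2⟩
  · intro s hs
    rw [uIcc_of_ge hC] at hs
    rw [a1]
    have := right_ray_mem (y := 0) hR hs.1 le_rfl
    rw [ofReal_zero, mul_zero, sub_zero] at this
    exact ⟨this.1.le, this.2⟩
  · intro s hs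
    rw [uIcc_of_ge hC] at hs
    rw [a2]
    exact ⟨by simp, by simpa using hs.1.trans (le_abs_self s)⟩

/-- The rotated copies of Γ meet both the closed exterior half-plane and 𝔰. Both sets are closed, so
continuity on each gives continuity on the union. -/
theorem continuousOn_union_stripBelow {R ε : ℝ} {φ : ℂ → ℂ}
    (hφ : DiffContOnCl ℂ φ (upperExterior R)) (hφs : ContinuousOn φ (stripBelow R ε)) :
    ContinuousOn φ ({l : ℂ | 0 ≤ l.im ∧ R ≤ ‖l‖} ∪ stripBelow R ε) := by
  refine ContinuousOn.union_of_isClosed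
    (hφ.continuousOn.mono fun l hl => mem_closure_upperExterior hl.1 hl.2) hφs ?_ ?_
  · exact (isClosed_le continuous_const continuous_im).inter
      (isClosed_le continuous_const continuous_norm)
  · exact (isClosed_le continuous_const continuous_re.abs).inter
      ((isClosed_le continuous_const continuous_im).inter
        (isClosed_le continuous_im continuous_const))

theorem norm_le_of_mem_stripBelow {R ε : ℝ} {l : ℂ} (hl : l ∈ stripBelow R ε) : R ≤ ‖l‖ :=
  hl.1.trans (abs_re_le_norm l)

/-- As for ∂D, with four rotated short segments in addition: two join the sides inside E to its arc,
and two join the lowered rays to ±R and survive in the limit. -/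
theorem tendsto_intGamma {a R ε t : ℝ} (hR : 0 < R) (haR : 4 * |a| ^ 3 < 27 * R ^ 6)
    (hε : 0 < ε) {φ : ℂ → ℂ} (hφ : DiffContOnCl ℂ φ (upperExterior R))
    (hφs : ContinuousOn φ (stripBelow R ε))
    (hφ0 : Tendsto φ (Bornology.cobounded ℂ ⊓ 𝓟 (closure (regionE' R ε) ∪ stripBelow R ε))
      (𝓝 0)) {k : ℕ} (hk : k ≤ 2) (ht : 0 < t) :
    Tendsto (fun C : ℝ =>
      intGamma R ε C fun l => exp (-I * l ^ 3 * t) * rotatedSum a k φ l) atTop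
      (𝓝 ((∫ z : ℝ in Ioi R, oscWeight a t k φ ((1 : ℝ) * z - I * ε)) +
        (∫ z : ℝ in Ioi R, oscWeight a t k φ ((-1 : ℝ) * z - I * ε)) +
        curveInt (fun y => R - I * y) 0 ε (oscWeight a t k φ) +
        curveInt (fun y => -R - I * y) ε 0 (oscWeight a t k φ) +
        curveInt (fun μ => R * exp (I * μ)) Real.pi 0 (oscWeight a t k φ))) := by
  set K : Set ℂ := {l : ℂ | 0 ≤ l.im ∧ R ≤ ‖l‖} ∪ stripBelow R ε with hKdef
  have hK : ∀ l : ℂ, 0 ≤ l.im → R ≤ ‖l‖ → l ∈ K := fun l h1 h2 => Or.inl ⟨h1, h2⟩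
  have hcont : ContinuousOn (oscWeight a t k φ) K := by
    refine continuousOn_oscWeight hR haR k ?_ (continuousOn_union_stripBelow hφ hφs)
    rintro l (hl | hl)
    · exact hl.2
    · exact norm_le_of_mem_stripBelow hl
  have r1 := intervalIntegral_tendsto_integral_Ioi R (integrableOn_oscWeight_shifted hR haR hε hφs
    subset_union_right hφ0 hk ht (σ := 1) (by simp)) tendsto_id
  have r2 := intervalIntegral_tendsto_integral_Ioi R (integrableOn_oscWeight_shifted hR haR hε hφs
    subset_union_right hφ0 hk ht (σ := -1) (by simp)) tendsto_id
  have r3 := tendsto_sides_of_gaussian hR haR hε hφ subset_union_left hφ0 hk ht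
  have r := ((((r1.add r2).add_const (curveInt (fun y => R - I * y) 0 ε (oscWeight a t k φ))).add_const
    (curveInt (fun y => -R - I * y) ε 0 (oscWeight a t k φ))).add r3).add_const
    (curveInt (fun μ => R * exp (I * μ)) (-(Real.pi / 3)) (-(2 * Real.pi / 3))
      (fun l => exp (-I * l ^ 3 * t) * rotatedSum a k φ l))
  rw [← curveInt_arc_rotatedSum hR hK hcont,
    add_comm (curveInt _ (-(Real.pi / 3)) (-(2 * Real.pi / 3)) _), ← add_assoc]
  refine r.congr' ?_
  have hof : ContDiff ℝ 1 fun μ : ℝ => (μ : ℂ) := ofRealCLM.contDiff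
  filter_upwards [eventually_ge_atTop R] with C hC
  have c3 := alpha_cubed
  have a1 : ∀ z y : ℝ, alpha * (alpha * (-z - I * y)) = alpha ^ 2 * (-z - I * y) :=
    fun z y => by ring
  have a2 : ∀ z y : ℝ, alpha ^ 2 * (alpha * (-z - I * y)) = -z - I * y := fun z y => by
    linear_combination (-z - I * y) * c3
  have a3 : ∀ z y : ℝ, alpha * (alpha ^ 2 * (z - I * y)) = z - I * y := fun z y => by
    linear_combination (z - I * y) * c3
  have a4 : ∀ z y : ℝ, alpha ^ 2 * (alpha ^ 2 * (z - I * y)) = alpha * (z - I * y) :=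
    fun z y => by linear_combination alpha * (z - I * y) * c3
  have m1 : ∀ z y : ℝ, R ≤ z → 0 ≤ y → alpha * (alpha * (-z - I * y)) ∈ K := fun z y h1 h2 => by
    rw [a1]
    have := right_ray_mem hR h1 h2
    exact hK _ this.1.le this.2
  have m2 : ∀ z y : ℝ, R ≤ z → 0 ≤ y → y ≤ ε → alpha ^ 2 * (alpha * (-z - I * y)) ∈ K :=
    fun z y h1 h2 h3 => by
      rw [a2]
      have := ray_mem_stripBelow (σ := -1) (by simp) hR h1 h2 h3
      exact Or.inr (by simpa using this)
  have m3 : ∀ z y : ℝ, R ≤ z → 0 ≤ y → y ≤ ε → alpha * (alpha ^ 2 * (z - I * y)) ∈ K :=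
    fun z y h1 h2 h3 => by
      rw [a3]
      have := ray_mem_stripBelow (σ := 1) (by simp) hR h1 h2 h3
      exact Or.inr (by simpa using this)
  have m4 : ∀ z y : ℝ, R ≤ z → 0 ≤ y → alpha ^ 2 * (alpha ^ 2 * (z - I * y)) ∈ K :=
    fun z y h1 h2 => by
      rw [a4]
      have := left_ray_mem hR h1 h2
      exact hK _ this.1.le this.2
  unfold intGamma
  rw [curveInt_rotatedSum hcont (c := fun z : ℝ => alpha * (-z - I * ε)) (by fun_prop)
      (fun s hs => m1 s ε (by rw [uIcc_of_ge hC] at hs; exact hs.1) hε.le)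
      (fun s hs => m2 s ε (by rw [uIcc_of_ge hC] at hs; exact hs.1) hε.le le_rfl),
    curveInt_rotatedSum hcont (c := fun y : ℝ => alpha * (-R - I * y)) (by fun_prop)
      (fun s hs => by rw [uIcc_of_ge hε.le] at hs; exact m1 R s le_rfl hs.1)
      (fun s hs => by rw [uIcc_of_ge hε.le] at hs; exact m2 R s le_rfl hs.1 hs.2),
    curveInt_rotatedSum hcont (c := fun y : ℝ => alpha ^ 2 * (R - I * y)) (by fun_prop)
      (fun s hs => by rw [uIcc_of_le hε.le] at hs; exact m3 R s le_rfl hs.1 hs.2)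
      (fun s hs => by rw [uIcc_of_le hε.le] at hs; exact m4 R s le_rfl hs.1),
    curveInt_rotatedSum hcont (c := fun z : ℝ => alpha ^ 2 * (z - I * ε)) (by fun_prop)
      (fun s hs => m3 s ε (by rw [uIcc_of_le hC] at hs; exact hs.1) hε.le le_rfl)
      (fun s hs => m4 s ε (by rw [uIcc_of_le hC] at hs; exact hs.1) hε.le)]
  simp only [a1, a2, a3, a4]
  rw [curveInt_right_ray, curveInt_left_ray]
  simp only [id]
  ring

/-! ### Deforming the rays of `Γ₋` -/

theorem phase_mul_eq (a t : ℝ) (x : ℝ) (χ : ℂ → ℂ) (l : ℂ) :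
    exp (I * nu a l * x - I * l ^ 3 * t) * χ l =
      exp (I * nu a l * x) * oscWeight a t 0 χ l := by
  rw [oscWeight, sub_eq_add_neg, exp_add, pow_zero, mul_one, neg_mul, neg_mul, mul_assoc]

theorem abs_nu_im_le {a M B : ℝ} {l : ℂ} (h : ‖nu a l - l‖ ≤ M) (hB : |l.im| ≤ B) :
    |(nu a l).im| ≤ M + B := by
  have h1 := (abs_im_le_norm (nu a l - l)).trans h
  rw [sub_im] at h1
  have := abs_sub_abs_le_abs_sub (nu a l).im l.im
  linarith

theorem continuousOn_nu_comp {a R : ℝ} (hR : 0 < R) (haR : 4 * |a| ^ 3 < 27 * R ^ 6) {c : ℝ → ℂ}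
    (hc : Continuous c) {S : Set ℝ} (hS : ∀ s ∈ S, R ≤ ‖c s‖) :
    ContinuousOn (fun s => nu a (c s)) S := fun s hs =>
  ((nu_differentiableAt (exterior_of_le hR haR (hS s hs))).continuousAt.comp
    hc.continuousAt).continuousWithinAt

theorem integrableOn_phase {a R M B t : ℝ} (hR : 0 < R) (haR : 4 * |a| ^ 3 < 27 * R ^ 6)
    (hM : ∀ l : ℂ, R ≤ ‖l‖ → ‖nu a l - l‖ ≤ M) {c : ℝ → ℂ} (hc : Continuous c) {S : Set ℝ}
    (hSm : MeasurableSet S) (hS : ∀ s ∈ S, R ≤ ‖c s‖ ∧ |(c s).im| ≤ B) {χ : ℂ → ℂ}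
    (hW : IntegrableOn (fun s => oscWeight a t 0 χ (c s)) S) (x : ℝ) :
    IntegrableOn (fun s => exp (I * nu a (c s) * x - I * c s ^ 3 * t) * χ (c s)) S := by
  simp only [phase_mul_eq]
  refine integrable_exp_I_mul (M := M + B)
    ((continuousOn_nu_comp hR haR hc fun s hs => (hS s hs).1).aestronglyMeasurable hSm) ?_ hW x
  filter_upwards [ae_restrict_mem hSm] with s hs
  exact abs_nu_im_le (hM _ (hS s hs).1) (hS s hs).2

theorem derivChain_of_integrableOn {a R M B t : ℝ} (hR : 0 < R)
    (haR : 4 * |a| ^ 3 < 27 * R ^ 6) (hM : ∀ l : ℂ, R ≤ ‖l‖ → ‖nu a l - l‖ ≤ M) {c w : ℝ → ℂ}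
    (hc : Continuous c) {S : Set ℝ} (hSm : MeasurableSet S)
    (hS : ∀ s ∈ S, R ≤ ‖c s‖ ∧ |(c s).im| ≤ B) {χ : ℂ → ℂ} {k : ℕ}
    (hW : ∀ j ≤ k, IntegrableOn (fun s => oscWeight a t j χ (c s) * w s) S) :
    DerivChain k (curveMoment a t χ c w (volume.restrict S)) := by
  refine derivChain_curveMoment (M := M + B)
    ((continuousOn_nu_comp hR haR hc fun s hs => (hS s hs).1).aestronglyMeasurable hSm) ?_ hW
  filter_upwards [ae_restrict_mem hSm] with s hs
  exact abs_nu_im_le (hM _ (hS s hs).1) (hS s hs).2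

theorem integrableOn_of_memLp_gammaMinus {R : ℝ} {θ : ℂ → ℂ}
    (hθ : MemLp θ 1 (gammaMinusMeasure R)) {σ : ℝ} (hσ : σ = 1 ∨ σ = -1) :
    IntegrableOn (fun z : ℝ => θ (σ * z)) (Ioi R) := by
  have h1 : MemLp θ 1 (Measure.map (fun s : ℝ => (s : ℂ)) (volume.restrict {s : ℝ | R ≤ |s|})) :=
    hθ.mono_measure (Measure.le_add_right le_rfl)
  have h2 := h1.comp_of_map continuous_ofReal.aemeasurable
  rw [memLp_one_iff_integrable] at h2
  have h3 : IntegrableOn (fun s : ℝ => θ s) {s : ℝ | R ≤ |s|} := h2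
  rcases hσ with rfl | rfl
  · simp only [ofReal_one, one_mul]
    exact h3.mono_set fun z hz => (le_of_lt hz).trans (le_abs_self z)
  · have h4 := (Measure.measurePreserving_neg (volume : Measure ℝ)).integrableOn_comp_preimage
      (Homeomorph.neg ℝ).measurableEmbedding (f := fun s : ℝ => θ s) (s := {s : ℝ | R ≤ |s|})
    have h5 := h4.2 h3
    refine (h5.mono_set fun z hz => ?_).congr_fun (fun z _ => ?_) measurableSet_Ioi
    · simpa using (le_of_lt hz).trans (le_abs_self z)
    · simp

theorem integrableOn_oscWeight_zero_of_integrableOn (a R t : ℝ) {θ : ℂ → ℂ} {σ : ℝ}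
    (hθ : IntegrableOn (fun z : ℝ => θ (σ * z)) (Ioi R)) :
    IntegrableOn (fun z : ℝ => oscWeight a t 0 θ (σ * z)) (Ioi R) := by
  simp only [oscWeight, pow_zero, mul_one]
  refine hθ.bdd_mul (c := 1) (Continuous.aestronglyMeasurable (by fun_prop)) (ae_of_all _ fun z => ?_)
  have h : (-I * (σ * z) ^ 3 * t : ℂ) = ((-((σ * z) ^ 3 * t) : ℝ) : ℂ) * I := by push_cast; ring
  rw [h, norm_exp_ofReal_mul_I]

/-- The shift is made before any differentiation: on the real ray the integrals of φν^j with j ≥ 1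
need not converge absolutely. -/
theorem integral_ray_shift {a R ε t : ℝ} (hR : 0 < R) (haR : 4 * |a| ^ 3 < 27 * R ^ 6)
    (hε : 0 < ε) {φ : ℂ → ℂ} (hφs : AnalyticOnNhd ℂ φ (stripBelow R ε)) {A : Set ℂ}
    (hA : stripBelow R ε ⊆ A) (hφ0 : Tendsto φ (Bornology.cobounded ℂ ⊓ 𝓟 A) (𝓝 0))
    (ht : 0 < t) {σ : ℝ} (hσ : σ = 1 ∨ σ = -1)
    (hint : IntegrableOn (fun z : ℝ => oscWeight a t 0 φ (σ * z)) (Ioi R)) (x : ℝ) :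
    ∫ z : ℝ in Ioi R, exp (I * nu a (σ * z) * x - I * (σ * z) ^ 3 * t) * φ (σ * z) =
      (∫ z : ℝ in Ioi R, exp (I * nu a (σ * z - I * ε) * x - I * (σ * z - I * ε) ^ 3 * t) *
        φ (σ * z - I * ε)) +
      ∫ s : ℝ in Ioc 0 ε, exp (I * nu a (σ * R - I * s) * x - I * (σ * R - I * s) ^ 3 * t) *
        φ (σ * R - I * s) * (-σ * I) := by
  obtain ⟨M, hM0, hM⟩ := exists_nu_sub_self_le hR haR
  have hσ1 : |σ| = 1 := by rcases hσ with rfl | rfl <;> simp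
  have hσ2 : σ * σ = 1 := by rcases hσ with rfl | rfl <;> simp
  have hσ2' : (σ : ℂ) * σ = 1 := by exact_mod_cast hσ2
  have hy : ∀ y ∈ uIcc 0 (-σ * ε), 0 ≤ -σ * y ∧ -σ * y ≤ ε := by
    intro y hy
    rcases hσ with rfl | rfl
    · rw [uIcc_of_ge (by linarith)] at hy
      constructor <;> linarith [hy.1, hy.2]
    · rw [uIcc_of_le (by linarith)] at hy
      constructor <;> linarith [hy.1, hy.2]
  have hpt : ∀ z y : ℝ, (σ : ℂ) * (z + y * I) = σ * z - I * (-σ * y : ℝ) := by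
    intro z y; push_cast; ring
  set f : ℂ → ℂ := fun l => exp (I * nu a l * x - I * l ^ 3 * t) * φ l with hf
  -- The substitution l ↦ σl reduces the left ray to the right one. It reverses the vertical
  -- direction when σ = -1, so lowering by ε means the height -σε.
  have key := integral_ray_eq_shifted (R := R) (η := -σ * ε) (f := fun l => f (σ * l)) ?_ ?_ ?_ ?_
  · have e1 : ∀ z : ℝ, (σ : ℂ) * (z + (-σ * ε : ℝ) * I) = σ * z - I * ε := by
      intro z
      rw [hpt]
      have : -σ * (-σ * ε) = ε := by linear_combination ε * hσ2
      rw [this]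
    simp only [e1, hpt] at key
    refine key.trans ?_
    congr 1
    rw [← intervalIntegral.integral_of_le hε.le, intervalIntegral.integral_mul_const]
    rcases hσ with rfl | rfl
    · have := intervalIntegral.integral_comp_neg (a := 0) (b := -(1 : ℝ) * ε)
        (fun y : ℝ => f ((1 : ℝ) * R - I * y))
      simp only [neg_mul, one_mul, neg_neg, neg_zero] at this ⊢
      rw [this, intervalIntegral.integral_symm]
      simp only [hf]
      push_cast
      ring
    · simp only [neg_neg, one_mul, hf]
      push_cast
      ring
  · intro l hl1 hl2
    obtain ⟨y1, y2⟩ := hy _ hl2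
    have hmem := ray_mem_stripBelow hσ1 hR hl1 y1 y2
    have hl : (σ : ℂ) * l = σ * l.re - I * (-σ * l.im : ℝ) := by
      rw [← hpt, re_add_im]
    rw [← hl] at hmem
    have d1 : DifferentiableAt ℂ φ (σ * l) := (hφs _ hmem).differentiableAt
    have d2 := nu_differentiableAt (exterior_of_le hR haR (norm_le_of_mem_stripBelow hmem))
    have d3 : DifferentiableAt ℂ f (σ * l) := by
      simp only [hf]
      fun_prop
    exact d3.comp l (by fun_prop)
  · refine integrableOn_phase (B := 0) hR haR hM (by fun_prop) measurableSet_Ioi ?_ hint x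
    intro z hz
    have hz' : R < z := hz
    refine ⟨?_, by simp⟩
    have := (ray_norm_bounds (y := 0) hσ1 (hR.le.trans hz'.le) le_rfl).1
    rw [ofReal_zero, mul_zero, sub_zero] at this
    linarith
  · have e1 : ∀ z : ℝ, (σ : ℂ) * (z + (-σ * ε : ℝ) * I) = σ * z - I * ε := by
      intro z
      rw [hpt]
      have : -σ * (-σ * ε) = ε := by linear_combination ε * hσ2
      rw [this]
    simp only [e1]
    refine integrableOn_phase (B := ε) hR haR hM (by fun_prop) measurableSet_Ioi ?_
      (integrableOn_oscWeight_shifted hR haR hε hφs.continuousOn hA hφ0 (Nat.zero_le 2) ht hσ1) x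
    intro z hz
    have hz' : R < z := hz
    refine ⟨hz'.le.trans (ray_norm_bounds hσ1 (hR.le.trans hz'.le) hε.le).1, ?_⟩
    simp [abs_of_pos hε]
  · intro δ hδ
    -- B bounds both exponentials throughout the strip. At its upper edge they do not decay, so the
    -- smallness on the far side must come from φ → 0.
    set B := Real.exp (|x| * (M + ε)) * Real.exp (t * ε ^ 3) with hB
    have hB0 : 0 < B := by positivity
    obtain ⟨r, hr⟩ := exists_bound_of_tendsto hφ0 (div_pos hδ hB0)
    filter_upwards [eventually_ge_atTop R, eventually_ge_atTop r] with C h1 h2 y hyy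
    obtain ⟨y1, y2⟩ := hy y hyy
    rw [hpt]
    have hmem := ray_mem_stripBelow hσ1 hR h1 y1 y2
    have hn := (ray_norm_bounds hσ1 (hR.le.trans h1) y1).1
    have him : |((σ : ℂ) * C - I * (-σ * y : ℝ)).im| ≤ ε := by
      have : ((σ : ℂ) * C - I * (-σ * y : ℝ)).im = -(-σ * y) := by simp
      rw [this, abs_neg, abs_of_nonneg y1]
      exact y2
    have b1 := norm_exp_I_mul_le (x := x) (abs_nu_im_le (hM _ (h1.trans hn)) him)
    have b2 : Real.exp (t * (((σ : ℂ) * C - I * (-σ * y : ℝ)) ^ 3).im) ≤ Real.exp (t * ε ^ 3) := by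
      rw [ray_cube_im hσ1]
      have : (-σ * y) ^ 3 ≤ ε ^ 3 := pow_le_pow_left₀ y1 y2 3
      have : 0 ≤ 3 * C ^ 2 * (-σ * y) := by positivity
      gcongr
      linarith
    have b3 := hr _ (hA hmem) (h2.trans hn)
    simp only [hf]
    rw [phase_mul_eq, norm_mul, norm_oscWeight, pow_zero, mul_one]
    calc _ ≤ Real.exp (|x| * (M + ε)) * (Real.exp (t * ε ^ 3) * (δ / B)) := by gcongr
      _ = δ := by rw [← mul_assoc, ← hB]; field_simp

theorem integral_ray_eq {a R ε t : ℝ} (hR : 0 < R) (haR : 4 * |a| ^ 3 < 27 * R ^ 6)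
    (hε : 0 < ε) {θ φ ψ : ℂ → ℂ} (hθ : MemLp θ 1 (gammaMinusMeasure R))
    (hsum : ∀ l ∈ closure (upperExterior R), θ l = φ l + ψ l)
    (hφs : AnalyticOnNhd ℂ φ (stripBelow R ε)) {A : Set ℂ}
    (hA : stripBelow R ε ⊆ A) (hφ0 : Tendsto φ (Bornology.cobounded ℂ ⊓ 𝓟 A) (𝓝 0))
    (ht : 0 < t) {σ : ℝ} (hσ : σ = 1 ∨ σ = -1)
    (hψi : IntegrableOn (fun z : ℝ => oscWeight a t 0 ψ (σ * z)) (Ioi R)) (x : ℝ) :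
    ∫ z : ℝ in Ioi R, exp (I * nu a (σ * z) * x - I * (σ * z) ^ 3 * t) * θ (σ * z) =
      (∫ z : ℝ in Ioi R, exp (I * nu a (σ * z) * x - I * (σ * z) ^ 3 * t) * ψ (σ * z)) +
      (∫ z : ℝ in Ioi R, exp (I * nu a (σ * z - I * ε) * x - I * (σ * z - I * ε) ^ 3 * t) *
        φ (σ * z - I * ε)) +
      ∫ s : ℝ in Ioc 0 ε, exp (I * nu a (σ * R - I * s) * x - I * (σ * R - I * s) ^ 3 * t) *
        φ (σ * R - I * s) * (-σ * I) := by
  obtain ⟨M, hM0, hM⟩ := exists_nu_sub_self_le hR haR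
  have hσ1 : |σ| = 1 := by rcases hσ with rfl | rfl <;> simp
  have hz : ∀ z ∈ Ioi R, R ≤ ‖(σ * z : ℂ)‖ ∧ |(σ * z : ℂ).im| ≤ 0 := by
    intro z hz
    have hz' : R < z := hz
    have := (ray_norm_bounds (y := 0) hσ1 (hR.le.trans hz'.le) le_rfl).1
    rw [ofReal_zero, mul_zero, sub_zero] at this
    exact ⟨by linarith, by simp⟩
  have hθz : ∀ z ∈ Ioi R, θ (σ * z) = φ (σ * z) + ψ (σ * z) := fun z h =>
    hsum _ (mem_closure_upperExterior (by simp) (hz z h).1)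
  have hθi := integrableOn_oscWeight_zero_of_integrableOn a R t
    (integrableOn_of_memLp_gammaMinus hθ hσ)
  -- No decay rate is known for φ; it is integrable here as the difference of θ, which is in L¹, and
  -- ψ.
  have hφi : IntegrableOn (fun z : ℝ => oscWeight a t 0 φ (σ * z)) (Ioi R) := by
    refine (hθi.sub hψi).congr_fun (fun z h => ?_) measurableSet_Ioi
    simp only [oscWeight, hθz z h, Pi.sub_apply]
    ring
  rw [add_assoc, ← integral_ray_shift hR haR hε hφs hA hφ0 ht hσ hφi x, ← integral_add
    (integrableOn_phase hR haR hM (by fun_prop) measurableSet_Ioi hz hψi x)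
    (integrableOn_phase hR haR hM (by fun_prop) measurableSet_Ioi hz hφi x)]
  refine setIntegral_congr_fun measurableSet_Ioi fun z h => ?_
  simp only [hθz z h]
  ring

/-! ### The integral along `Γ₋` as a sum of moments -/

theorem deriv_arc (R μ : ℝ) :
    deriv (fun μ : ℝ => (R : ℂ) * exp (I * μ)) μ = I * (R * exp (I * μ)) := by
  have h1 : HasDerivAt (fun μ : ℝ => I * (μ : ℂ)) I μ := by
    simpa using (ofRealCLM.hasDerivAt (x := μ)).const_mul I
  rw [(h1.cexp.const_mul (R : ℂ)).deriv]
  ring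

theorem curveInt_arc_eq (R : ℝ) (f : ℂ → ℂ) :
    curveInt (fun μ => R * exp (I * μ)) Real.pi 0 f =
      ∫ μ in Ioc 0 Real.pi, f (R * exp (I * μ)) * -(I * (R * exp (I * μ))) := by
  rw [curveInt, intervalIntegral.integral_symm, intervalIntegral.integral_of_le Real.pi_pos.le,
    ← integral_neg]
  simp only [deriv_arc, mul_neg]

/-- The sum of the moments over the pieces of the deformed contour: the rays carrying `ψ`, the
lowered rays and the vertical segments carrying `φ`, and the arc carrying `θ`. -/
def momentSum (a R ε t : ℝ) (θ φ ψ : ℂ → ℂ) (j : ℕ) (x : ℝ) : ℂ :=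
  (curveMoment a t ψ (fun z => (1 : ℝ) * z) (fun _ => 1) (volume.restrict (Ioi R)) j x +
    curveMoment a t φ (fun z => (1 : ℝ) * z - I * ε) (fun _ => 1) (volume.restrict (Ioi R)) j x +
    curveMoment a t φ (fun s => (1 : ℝ) * R - I * s) (fun _ => -(1 : ℝ) * I)
      (volume.restrict (Ioc 0 ε)) j x) +
  (curveMoment a t ψ (fun z => (-1 : ℝ) * z) (fun _ => 1) (volume.restrict (Ioi R)) j x +
    curveMoment a t φ (fun z => (-1 : ℝ) * z - I * ε) (fun _ => 1) (volume.restrict (Ioi R)) j x +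
    curveMoment a t φ (fun s => (-1 : ℝ) * R - I * s) (fun _ => -(-1 : ℝ) * I)
      (volume.restrict (Ioc 0 ε)) j x) +
  curveMoment a t θ (fun μ => R * exp (I * μ)) (fun μ => -(I * (R * exp (I * μ))))
    (volume.restrict (Ioc 0 Real.pi)) j x

theorem integrableOn_oscWeight_arc {a R t : ℝ} (hR : 0 < R) (haR : 4 * |a| ^ 3 < 27 * R ^ 6)
    (k : ℕ) {χ : ℂ → ℂ} (hχ : ContinuousOn χ (closure (upperExterior R))) :
    IntegrableOn (fun μ : ℝ => oscWeight a t k χ (R * exp (I * μ)) * -(I * (R * exp (I * μ))))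
      (Ioc 0 Real.pi) := by
  have h1 := continuousOn_oscWeight (t := t) hR haR k
    (fun l hl => closure_upperExterior_norm hl) hχ
  have h2 : ContinuousOn (fun μ : ℝ => oscWeight a t k χ (R * exp (I * μ))) (Icc 0 Real.pi) :=
    h1.comp (by fun_prop) fun μ hμ => arc_mem hR (fun l => mem_closure_upperExterior) hμ
  exact ((h2.mul (by fun_prop)).integrableOn_Icc).mono_set Ioc_subset_Icc_self

theorem integrableOn_oscWeight_segment {a R ε t : ℝ} (hR : 0 < R)
    (haR : 4 * |a| ^ 3 < 27 * R ^ 6) {φ : ℂ → ℂ} (hφs : ContinuousOn φ (stripBelow R ε)) (k : ℕ)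
    {σ : ℝ} (hσ : |σ| = 1) (w : ℂ) :
    IntegrableOn (fun s : ℝ => oscWeight a t k φ (σ * R - I * s) * w) (Ioc 0 ε) := by
  have h1 := continuousOn_oscWeight (t := t) hR haR k
    (fun l hl => norm_le_of_mem_stripBelow hl) hφs
  have h2 : ContinuousOn (fun s : ℝ => oscWeight a t k φ (σ * R - I * s)) (Icc 0 ε) :=
    h1.comp (by fun_prop) fun s hs => ray_mem_stripBelow hσ hR le_rfl hs.1 hs.2
  exact ((h2.mul_const w).integrableOn_Icc).mono_set Ioc_subset_Icc_self

theorem derivChain_side {a R ε t : ℝ} (hR : 0 < R) (haR : 4 * |a| ^ 3 < 27 * R ^ 6)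
    (hε : 0 < ε) {φ ψ : ℂ → ℂ} (hψ : DiffContOnCl ℂ ψ (upperExterior R)) {A B : Set ℂ}
    (hA : gammaMinus R ⊆ A) (hψO : ψ =O[Bornology.cobounded ℂ ⊓ 𝓟 A] fun l => l ^ (-4 : ℤ))
    (hφs : ContinuousOn φ (stripBelow R ε)) (hB : stripBelow R ε ⊆ B)
    (hφ0 : Tendsto φ (Bornology.cobounded ℂ ⊓ 𝓟 B) (𝓝 0))
    {k : ℕ} (hk : k ≤ 2) (ht : 0 < t) {σ : ℝ} (hσ : |σ| = 1) :
    DerivChain k fun j x =>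
      curveMoment a t ψ (fun z => σ * z) (fun _ => 1) (volume.restrict (Ioi R)) j x +
      curveMoment a t φ (fun z => σ * z - I * ε) (fun _ => 1) (volume.restrict (Ioi R)) j x +
      curveMoment a t φ (fun s => σ * R - I * s) (fun _ => -σ * I)
        (volume.restrict (Ioc 0 ε)) j x := by
  obtain ⟨M, hM0, hM⟩ := exists_nu_sub_self_le hR haR
  refine (DerivChain.add ?_ ?_).add ?_
  · refine derivChain_of_integrableOn (B := 0) hR haR hM (by fun_prop) measurableSet_Ioi ?_ ?_
    · intro z hz
      have hz' : R < z := hz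
      have := (ray_norm_bounds (y := 0) hσ (hR.le.trans hz'.le) le_rfl).1
      rw [ofReal_zero, mul_zero, sub_zero] at this
      exact ⟨by linarith, by simp⟩
    · intro j hj
      simpa only [mul_one] using
        integrableOn_oscWeight_real hR haR hψ hA hψO (hj.trans hk) ht hσ
  · refine derivChain_of_integrableOn (B := ε) hR haR hM (by fun_prop) measurableSet_Ioi ?_ ?_
    · intro z hz
      have hz' : R < z := hz
      refine ⟨hz'.le.trans (ray_norm_bounds hσ (hR.le.trans hz'.le) hε.le).1, ?_⟩
      simp [abs_of_pos hε]
    · intro j hj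
      simpa only [mul_one] using
        integrableOn_oscWeight_shifted hR haR hε hφs hB hφ0 (hj.trans hk) ht hσ
  · refine derivChain_of_integrableOn (B := ε) hR haR hM (by fun_prop) measurableSet_Ioc ?_
      fun j _ => integrableOn_oscWeight_segment hR haR hφs j hσ _
    intro s hs
    refine ⟨(ray_norm_bounds hσ hR.le hs.1.le).1, ?_⟩
    simpa [abs_of_pos hs.1] using hs.2

theorem continuousOn_of_sum {R : ℝ} {θ φ ψ : ℂ → ℂ}
    (hsum : ∀ l ∈ closure (upperExterior R), θ l = φ l + ψ l)
    (hφ : DiffContOnCl ℂ φ (upperExterior R)) (hψ : DiffContOnCl ℂ ψ (upperExterior R)) :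
    ContinuousOn θ (closure (upperExterior R)) :=
  (hφ.continuousOn.add hψ.continuousOn).congr hsum

theorem derivChain_momentSum {a R ε t : ℝ} (hR : 0 < R) (haR : 4 * |a| ^ 3 < 27 * R ^ 6)
    (hε : 0 < ε) {θ φ ψ : ℂ → ℂ} (hθ : ContinuousOn θ (closure (upperExterior R)))
    (hψ : DiffContOnCl ℂ ψ (upperExterior R)) {A B : Set ℂ}
    (hA : gammaMinus R ⊆ A) (hψO : ψ =O[Bornology.cobounded ℂ ⊓ 𝓟 A] fun l => l ^ (-4 : ℤ))
    (hφs : ContinuousOn φ (stripBelow R ε)) (hB : stripBelow R ε ⊆ B)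
    (hφ0 : Tendsto φ (Bornology.cobounded ℂ ⊓ 𝓟 B) (𝓝 0))
    {k : ℕ} (hk : k ≤ 2) (ht : 0 < t) : DerivChain k (momentSum a R ε t θ φ ψ) := by
  obtain ⟨M, hM0, hM⟩ := exists_nu_sub_self_le hR haR
  refine (DerivChain.add (derivChain_side hR haR hε hψ hA hψO hφs hB hφ0 hk ht (by simp))
    (derivChain_side hR haR hε hψ hA hψO hφs hB hφ0 hk ht (by simp))).add ?_
  refine derivChain_of_integrableOn (B := R) hR haR hM (by fun_prop) measurableSet_Ioc ?_
    fun j _ => integrableOn_oscWeight_arc hR haR j hθ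
  intro μ _
  refine ⟨(norm_arc hR.le μ).ge, ?_⟩
  simpa only [norm_arc hR.le] using abs_im_le_norm ((R : ℂ) * exp (I * μ))

theorem intGammaMinus_eq_momentSum {a R ε t : ℝ} (hR : 0 < R)
    (haR : 4 * |a| ^ 3 < 27 * R ^ 6) (hε : 0 < ε) {θ φ ψ : ℂ → ℂ}
    (hθ : MemLp θ 1 (gammaMinusMeasure R))
    (hsum : ∀ l ∈ closure (upperExterior R), θ l = φ l + ψ l)
    (hψ : DiffContOnCl ℂ ψ (upperExterior R)) {A B : Set ℂ}
    (hA : gammaMinus R ⊆ A) (hψO : ψ =O[Bornology.cobounded ℂ ⊓ 𝓟 A] fun l => l ^ (-4 : ℤ))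
    (hφs : AnalyticOnNhd ℂ φ (stripBelow R ε)) (hB : stripBelow R ε ⊆ B)
    (hφ0 : Tendsto φ (Bornology.cobounded ℂ ⊓ 𝓟 B) (𝓝 0)) (ht : 0 < t) :
    (fun x : ℝ => intGammaMinus R fun l => exp (I * nu a l * x - I * l ^ 3 * t) * θ l) =
      momentSum a R ε t θ φ ψ 0 := by
  funext x
  have h1 := integral_ray_eq hR haR hε hθ hsum hφs hB hφ0 ht (Or.inl rfl)
    (integrableOn_oscWeight_real hR haR hψ hA hψO (Nat.zero_le 2) ht (by simp)) x
  have h2 := integral_ray_eq hR haR hε hθ hsum hφs hB hφ0 ht (Or.inr rfl)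
    (integrableOn_oscWeight_real hR haR hψ hA hψO (Nat.zero_le 2) ht (by simp)) x
  simp only [momentSum, curveMoment_zero_left, mul_one]
  rw [← h1, ← h2, intGammaMinus, curveInt_arc_eq, integral_Ici_eq_integral_Ioi,
    ← integral_comp_neg_Ioi]
  simp only [ofReal_neg, ofReal_one, one_mul, neg_mul]
  ring

/-- On the arc θ splits into φ + ψ, and the terms are regrouped so that the two brackets are the
limits in `tendsto_intBoundaryD` and `tendsto_intGamma`. -/
theorem momentSum_at_zero {a R ε t : ℝ} (hR : 0 < R) (haR : 4 * |a| ^ 3 < 27 * R ^ 6)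
    (hε : 0 < ε) {θ φ ψ : ℂ → ℂ}
    (hsum : ∀ l ∈ closure (upperExterior R), θ l = φ l + ψ l)
    (hφ : DiffContOnCl ℂ φ (upperExterior R)) (hψ : DiffContOnCl ℂ ψ (upperExterior R)) (k : ℕ) :
    (-I) ^ k * momentSum a R ε t θ φ ψ k 0 =
      ((∫ z : ℝ in Ioi R, oscWeight a t k ψ ((1 : ℝ) * z)) +
        (∫ z : ℝ in Ioi R, oscWeight a t k ψ ((-1 : ℝ) * z)) +
        curveInt (fun μ => R * exp (I * μ)) Real.pi 0 (oscWeight a t k ψ)) +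
      ((∫ z : ℝ in Ioi R, oscWeight a t k φ ((1 : ℝ) * z - I * ε)) +
        (∫ z : ℝ in Ioi R, oscWeight a t k φ ((-1 : ℝ) * z - I * ε)) +
        curveInt (fun y => R - I * y) 0 ε (oscWeight a t k φ) +
        curveInt (fun y => -R - I * y) ε 0 (oscWeight a t k φ) +
        curveInt (fun μ => R * exp (I * μ)) Real.pi 0 (oscWeight a t k φ)) := by
  have harc : ∫ μ in Ioc 0 Real.pi,
      oscWeight a t k θ (R * exp (I * μ)) * -(I * (R * exp (I * μ))) =
      curveInt (fun μ => R * exp (I * μ)) Real.pi 0 (oscWeight a t k ψ) +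
      curveInt (fun μ => R * exp (I * μ)) Real.pi 0 (oscWeight a t k φ) := by
    rw [curveInt_arc_eq, curveInt_arc_eq, ← integral_add
      (integrableOn_oscWeight_arc hR haR k hψ.continuousOn)
      (integrableOn_oscWeight_arc hR haR k hφ.continuousOn)]
    refine setIntegral_congr_fun measurableSet_Ioc fun μ hμ => ?_
    have := hsum _ (arc_mem hR (fun l => mem_closure_upperExterior) (Ioc_subset_Icc_self hμ))
    simp only [oscWeight, this]
    ring
  have hright : curveInt (fun y => R - I * y) 0 ε (oscWeight a t k φ) =
      ∫ s in Ioc 0 ε, oscWeight a t k φ ((1 : ℝ) * R - I * s) * (-(1 : ℝ) * I) := by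
    have h := curveInt_line (-I) R 0 ε (oscWeight a t k φ)
    rw [← intervalIntegral.integral_of_le hε.le, intervalIntegral.integral_mul_const]
    simp only [ofReal_one, one_mul, neg_one_mul]
    have e : ∀ s : ℝ, -I * s + R = R - I * s := fun s => by ring
    simp only [e] at h
    exact h
  have hleft : curveInt (fun y => -R - I * y) ε 0 (oscWeight a t k φ) =
      ∫ s in Ioc 0 ε, oscWeight a t k φ ((-1 : ℝ) * R - I * s) * (-(-1 : ℝ) * I) := by
    have h := curveInt_line (-I) (-R) 0 ε (oscWeight a t k φ)
    rw [curveInt_symm, ← intervalIntegral.integral_of_le hε.le,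
      intervalIntegral.integral_mul_const]
    simp only [ofReal_one, ofReal_neg, one_mul, neg_one_mul, neg_neg]
    have e : ∀ s : ℝ, -I * s + -R = -R - I * s := fun s => by ring
    simp only [e] at h
    rw [h]
    ring
  simp only [momentSum, mul_add, curveMoment_zero_right]
  rw [harc, hright, hleft]
  simp only [mul_one]
  ring

end VertexRewriting

end

/-! ### The limit at x = 0 -/

theorem mainTheorem1 (a R ε : ℝ) (hR : 0 < R) (haR : 4 * |a| ^ 3 < 27 * R ^ 6) (hε : 0 < ε)
    (θ φ ψ : ℂ → ℂ)
    (hθ1 : MemLp θ 1 (gammaMinusMeasure R))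
    (hθtop : MemLp θ ⊤ (gammaMinusMeasure R))
    (hsum : ∀ l ∈ closure (upperExterior R), θ l = φ l + ψ l)
    (hφ : DiffContOnCl ℂ φ (upperExterior R))
    (hψ : DiffContOnCl ℂ ψ (upperExterior R))
    (hψO : ψ =O[Bornology.cobounded ℂ ⊓ 𝓟 (gammaMinus R ∪ closure (regionE R))]
      fun l => l ^ (-4 : ℤ))
    (hφs : AnalyticOnNhd ℂ φ (stripBelow R ε))
    (hφ0 : Tendsto φ (Bornology.cobounded ℂ ⊓ 𝓟 (closure (regionE' R ε) ∪ stripBelow R ε))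
      (𝓝 0))
    (k : ℕ) (hk : k ≤ 2) (t : ℝ) (ht : 0 < t) :
    ContDiffOn ℝ k
      (fun x : ℝ => intGammaMinus R fun l => exp (I * nu a l * x - I * l ^ 3 * t) * θ l)
      (Iio 0) ∧
    ∃ L : ℂ,
      Tendsto
        (fun x : ℝ => (-I) ^ k * iteratedDeriv k
          (fun x : ℝ => intGammaMinus R fun l => exp (I * nu a l * x - I * l ^ 3 * t) * θ l) x)
        (𝓝[<] 0) (𝓝 L) ∧
      Tendsto
        (fun C : ℝ =>
          (intBoundaryD R C fun l => exp (-I * l ^ 3 * t) * rotatedSum a k ψ l) +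
          intGamma R ε C fun l => exp (-I * l ^ 3 * t) * rotatedSum a k φ l)
        atTop (𝓝 L) := by
  have hF := intGammaMinus_eq_momentSum hR haR hε hθ1 hsum hψ subset_union_left hψO hφs
    subset_union_right hφ0 ht
  have hG := derivChain_momentSum hR haR hε (continuousOn_of_sum hsum hφ hψ) hψ subset_union_left
    hψO hφs.continuousOn subset_union_right hφ0 hk ht
  rw [hF]
  -- The moments are continuous on all of ℝ, so the limit from the left is the value at 0.
  refine ⟨hG.contDiff.contDiffOn, (-I) ^ k * momentSum a R ε t θ φ ψ k 0, ?_, ?_⟩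
  · rw [hG.iteratedDeriv_eq k le_rfl]
    exact (((hG.continuous k le_rfl).const_mul _).tendsto 0).mono_left nhdsWithin_le_nhds
  · rw [momentSum_at_zero hR haR hε hsum hφ hψ]
    exact (tendsto_intBoundaryD hR haR hψ hψO hk ht).add
      (tendsto_intGamma hR haR hε hφ hφs.continuousOn hφ0 hk ht)
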